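/- Let $n\ge 0$ be an integer, let $\alpha\in(0,1)$, and let $\mathbf X_1,\mathbf X_2,\mathbf Z_1,\mathbf Z_2$ be mutually independent random vectors in $\mathbb R^n$. Assume that $\mathbf Z_1,\mathbf Z_2\sim\mathcal N(0,\mathbf I)$, and that $\mathbf X_1$ and $\mathbf X_2$ each have finite second moments and a continuous, positive, differentiable probability density. For $\gamma>0$ put $$\mathbf X=\sqrt{1-\alpha}\,\mathbf X_1+\sqrt{\alpha}\,\mathbf X_2,\qquad \mathbf Y_{i,\gamma}=\sqrt{\gamma}\,\mathbf X_i+\mathbf Z_i\ (i=1,2),\qquad \mathbf Y_\gamma=\sqrt{1-\alpha}\,\mathbf Y_{1,\gamma}+\sqrt{\alpha}\,\mathbf Y_{2,\gamma}.$$ For a random vector $\mathbf V$ with continuous density $f_{\mathbf V}$, let $\rho_{\mathbf V}=\nabla\log f_{\mathbf V}$ be its score function and $J(\mathbf V)=\mathbb E\,\|\rho_{\mathbf V}(\mathbf V)\|^2\in[0,\infty]$ its Fisher information. Define $$\Delta(\mathbf X_1\|\mathbf X_2)=\frac12\int_0^\infty \mathbb E\Big[\big\|\mathbb E[\mathbf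 X\mid \mathbf Y_\gamma]-\mathbb E[\mathbf X\mid \mathbf Y_{1,\gamma},\mathbf Y_{2,\gamma}]\big\|^2\Big]\,d\gamma\in[0,\infty].$$ Then for every $\gamma>0$ the following six statements are equivalent: 1. $\Delta(\mathbf X_1\|\mathbf X_2)=0$; 2. $\mathbb E[\mathbf X\mid \mathbf Y_\gamma]=\mathbb E[\mathbf X\mid \mathbf Y_{1,\gamma},\mathbf Y_{2,\gamma}]$ a.s.; 3. $\mathbb E\big[\sqrt{1-\alpha}\,\mathbb E[\mathbf X_1\mid \mathbf Y_{1,\gamma}]+\sqrt\alpha\,\mathbb E[\mathbf X_2\mid \mathbf Y_{2,\gamma}]\,\big|\,\mathbf Y_\gamma\big]=\sqrt{1-\alpha}\,\mathbb E[\mathbf X_1\mid \mathbf Y_{1,\gamma}]+\sqrt\alpha\,\mathbb E[\mathbf X_2\mid \mathbf Y_{2,\gamma}]$ a.s.; 4. $\mathbb E\big[\sqrt{1-\alpha}\,\rho_{\mathbf Y_{1,\gamma}}(\mathbf Y_{1,\gamma})+\sqrt\alpha\,\rho_{\mathbf Y_{2,\gamma}}(\mathbf Y_{2,\gamma})\,\big|\,\mathbf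 Y_\gamma\big]=\sqrt{1-\alpha}\,\rho_{\mathbf Y_{1,\gamma}}(\mathbf Y_{1,\gamma})+\sqrt\alpha\,\rho_{\mathbf Y_{2,\gamma}}(\mathbf Y_{2,\gamma})$ a.s.; 5. $\rho_{\mathbf Y_\gamma}(\mathbf Y_\gamma)=\sqrt{1-\alpha}\,\rho_{\mathbf Y_{1,\gamma}}(\mathbf Y_{1,\gamma})+\sqrt\alpha\,\rho_{\mathbf Y_{2,\gamma}}(\mathbf Y_{2,\gamma})$ a.s.; 6. $(1-\alpha)\,J(\mathbf Y_{1,\gamma})+\alpha\,J(\mathbf Y_{2,\gamma})=J(\mathbf Y_\gamma)$. Moreover, these statements hold if and only if $\mathbf X_1$ and $\mathbf X_2$ are Gaussian with identical covariance matrices. -/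

import Mathlib

open MeasureTheory ProbabilityTheory Real
open scoped ENNReal Gradient

noncomputable section

namespace EPI

/-- Euclidean space of dimension `n`, with its Euclidean norm and Lebesgue measure. -/
abbrev E (n : ℕ) : Type := EuclideanSpace ℝ (Fin n)

/-- `f` is a continuous probability density function of the random vector `X` under `P`. -/
structure IsContDensity {n : ℕ} {Ω : Type*} {mΩ : MeasurableSpace Ω} (X : Ω → E n)
    (P : Measure Ω) (f : E n → ℝ) : Prop where
  continuous : Continuous f
  nonneg : ∀ x, 0 ≤ f x
  map_eq : P.map X = (volume : Measure (E n)).withDensity (fun x => ENNReal.ofReal (f x))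

/-- A continuous density is unique (everywhere, not only almost everywhere). -/
theorem IsContDensity.unique {n : ℕ} {Ω : Type*} {mΩ : MeasurableSpace Ω} {X : Ω → E n}
    {P : Measure Ω} [IsFiniteMeasure P] {f g : E n → ℝ} (hf : IsContDensity X P f)
    (hg : IsContDensity X P g) : f = g := by
  have hfm : Measurable (fun x => ENNReal.ofReal (f x)) :=
    hf.continuous.measurable.ennreal_ofReal
  have hgm : Measurable (fun x => ENNReal.ofReal (g x)) :=
    hg.continuous.measurable.ennreal_ofReal
  have h : (fun x => ENNReal.ofReal (f x)) =ᵐ[volume] fun x => ENNReal.ofReal (g x) := by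
    refine (withDensity_eq_iff_of_sigmaFinite hfm.aemeasurable hgm.aemeasurable).1 ?_
    rw [← hf.map_eq, ← hg.map_eq]
  have h2 := (Continuous.ae_eq_iff_eq volume
    (ENNReal.continuous_ofReal.comp hf.continuous)
    (ENNReal.continuous_ofReal.comp hg.continuous)).1 h
  funext x
  have h3 : ENNReal.ofReal (f x) = ENNReal.ofReal (g x) := congrFun h2 x
  exact (ENNReal.ofReal_eq_ofReal_iff (hf.nonneg x) (hg.nonneg x)).1 h3

/-- `X` has a continuous, positive and differentiable probability density. -/
def HasRegularDensity {n : ℕ} {Ω : Type*} {mΩ : MeasurableSpace Ω} (X : Ω → E n)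
    (P : Measure Ω) : Prop :=
  ∃ f : E n → ℝ, IsContDensity X P f ∧ (∀ x, 0 < f x) ∧ Differentiable ℝ f

open Classical in
/-- The probability density `f_X` of `X`: the (unique) continuous one; `0` if there is none. -/
def density {n : ℕ} {Ω : Type*} {mΩ : MeasurableSpace Ω} (X : Ω → E n) (P : Measure Ω) :
    E n → ℝ :=
  if h : ∃ f : E n → ℝ, IsContDensity X P f then h.choose else 0

theorem IsContDensity.density_eq {n : ℕ} {Ω : Type*} {mΩ : MeasurableSpace Ω} {X : Ω → E n}
    {P : Measure Ω} [IsFiniteMeasure P] {f : E n → ℝ} (hf : IsContDensity X P f) :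
    density X P = f := by
  have h : ∃ f : E n → ℝ, IsContDensity X P f := ⟨f, hf⟩
  rw [density, dif_pos h]
  exact h.choose_spec.unique hf

/-- The score function `ρ_X(x) = ∇ log f_X(x)`. -/
def score {n : ℕ} {Ω : Type*} {mΩ : MeasurableSpace Ω} (X : Ω → E n) (P : Measure Ω)
    (x : E n) : E n :=
  ∇ (fun y => Real.log (density X P y)) x

/-- The Fisher information `J(X) = E[ρ_X(X)ᵀ ρ_X(X)]`, with values in `[0, ∞]`. -/
def fisherInfo {n : ℕ} {Ω : Type*} {mΩ : MeasurableSpace Ω} (X : Ω → E n) (P : Measure Ω) :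
    ℝ≥0∞ :=
  ∫⁻ ω, ‖score X P (X ω)‖ₑ ^ 2 ∂P

/-- The covariance matrix `K_X`. -/
def covMatrix {n : ℕ} {Ω : Type*} {mΩ : MeasurableSpace Ω} (X : Ω → E n) (P : Measure Ω) :
    Matrix (Fin n) (Fin n) ℝ :=
  Matrix.of fun i j => cov[fun ω => X ω i, fun ω => X ω j; P]

/-- The output `√γ X + Z` of the additive noise channel. -/
def chan {n : ℕ} {Ω : Type*} (γ : ℝ) (X Z : Ω → E n) : Ω → E n :=
  fun ω => √γ • X ω + Z ω

/-- The combination `√(1-α) U + √α V`. -/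
def mix {n : ℕ} {Ω : Type*} (α : ℝ) (U V : Ω → E n) : Ω → E n :=
  fun ω => √(1 - α) • U ω + √α • V ω

/-- The conditional expectation `E[X | Y]` given (the σ-algebra generated by) `Y`. -/
def condMean {n : ℕ} {Ω F : Type*} [MeasurableSpace F] {mΩ : MeasurableSpace Ω}
    (P : Measure Ω) (X : Ω → E n) (Y : Ω → F) : Ω → E n :=
  P[X | MeasurableSpace.comap Y inferInstance]

/-- The deficit
`Δ(X₁‖X₂) = ½ ∫₀^∞ E ‖E[X | √(1-α) Y₁ + √α Y₂] - E[X | Y₁, Y₂]‖² dγ`, with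
`X = √(1-α) X₁ + √α X₂` and `Yᵢ = √γ Xᵢ + Zᵢ`; the integrand is nonnegative and the value is
taken in `[0, ∞]`. -/
def deficit {n : ℕ} {Ω : Type*} {mΩ : MeasurableSpace Ω} (P : Measure Ω) (α : ℝ)
    (X₁ X₂ Z₁ Z₂ : Ω → E n) : ℝ≥0∞ :=
  (1 / 2) * ∫⁻ γ in Set.Ioi (0 : ℝ), ∫⁻ ω,
    ‖condMean P (mix α X₁ X₂) (mix α (chan γ X₁ Z₁) (chan γ X₂ Z₂)) ω
      - condMean P (mix α X₁ X₂) (fun ω' => (chan γ X₁ Z₁ ω', chan γ X₂ Z₂ ω')) ω‖ₑ ^ 2 ∂P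

end EPI

end

open EPI

/-! Everything rests on two facts about a Gaussian channel `√γ X + Z`. Its output has a smooth,
everywhere positive density, and Bayes' rule gives the conditional mean of `X` as an explicit
continuous function of the output (`condMean_chan`). Tweedie's formula (`gradient_log_outDens`) says
that the score at `y` is `√γ` times this posterior mean, minus `y`. The mixed output `Y` is itself
such a channel (`mix_chan`), so the score statements 4 and 5 are images of statement 2 under the
injective map `u ↦ √γ u - Y`. Statement 3 follows from the tower property. In statement 6, the score
of `Y` is the `L²` projection of the mixed score, and a projection has the same norm as the vector
only if it equals it.

The core is that statement 2, at any single `γ > 0`, characterises Gaussian inputs with equal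
covariance. Statement 2 reads `g (a Y₁ + b Y₂) = a g₁ Y₁ + b g₂ Y₂` with continuous posterior means.
The outputs are independent with full support, so this holds everywhere; it is Pexider's equation,
and `g₁`, `g₂` are affine with a common linear part. An affine posterior mean is a first-order
linear differential equation for the characteristic function of the input along each line, whose
solution is Gaussian with variance fixed by the linear part (`map_inner_of_condMean_affine`).
Conversely, for Gaussian inputs with equal covariance, the rotated output `b Y₁ - a Y₂` is
independent of `(X, Y)` and adds no information (`condMean_mix_of_gaussian`).

The Gaussian condition does not involve `γ`, so the integrand of the deficit vanishes at one `γ > 0`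
exactly when it vanishes at all of them. This links statement 1 to the others. -/

open scoped RealInnerProductSpace

namespace EPI

variable {n : ℕ} {Ω : Type*} {mΩ : MeasurableSpace Ω}

/-! ### The density of the standard Gaussian vector -/

/-- The density of the standard Gaussian measure on `E n`. -/
noncomputable def gaussDens (v : E n) : ℝ := (2 * π) ^ (-(n / 2 : ℝ)) * rexp (-(1 / 2) * ‖v‖ ^ 2)

lemma gaussDens_pos (v : E n) : 0 < gaussDens v := by unfold gaussDens; positivity

lemma continuous_gaussDens : Continuous (gaussDens (n := n)) := by
  unfold gaussDens; fun_prop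

lemma measurable_gaussDens : Measurable (gaussDens (n := n)) := continuous_gaussDens.measurable

lemma gaussDens_le (v : E n) : gaussDens v ≤ (2 * π) ^ (-(n / 2 : ℝ)) := by
  unfold gaussDens
  refine mul_le_of_le_one_right (by positivity) (Real.exp_le_one_iff.2 ?_)
  nlinarith [sq_nonneg ‖v‖]

/-- The left side is the norm of the gradient of `gaussDens`; this uniform bound is the dominating
constant when `outDens` is differentiated under the integral. -/
lemma norm_mul_gaussDens_le (v : E n) : ‖v‖ * gaussDens v ≤ (2 * π) ^ (-(n / 2 : ℝ)) := by
  unfold gaussDens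
  rw [mul_left_comm]
  refine mul_le_of_le_one_right (by positivity) ?_
  have h1 : ‖v‖ ≤ rexp ((1 / 2) * ‖v‖ ^ 2) := by
    have := Real.add_one_le_exp ((1 / 2) * ‖v‖ ^ 2)
    nlinarith [sq_nonneg (‖v‖ - 1)]
  calc ‖v‖ * rexp (-(1 / 2) * ‖v‖ ^ 2)
      ≤ rexp ((1 / 2) * ‖v‖ ^ 2) * rexp (-(1 / 2) * ‖v‖ ^ 2) := by gcongr
    _ = 1 := by rw [← Real.exp_add]; simp

lemma hasFDerivAt_gaussDens (v : E n) :
    HasFDerivAt gaussDens (-(gaussDens v) • innerSL ℝ v) v := by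
  have h := ((hasStrictFDerivAt_norm_sq v).hasFDerivAt.const_mul (-(1 / 2 : ℝ))).exp.const_mul
    ((2 * π) ^ (-(n / 2 : ℝ)))
  refine h.congr_fderiv ?_
  ext w
  simp [gaussDens]
  ring

lemma integral_gaussDens : ∫ v : E n, gaussDens v = 1 := by
  unfold gaussDens
  rw [integral_const_mul, GaussianFourier.integral_rexp_neg_mul_sq_norm (by norm_num)]
  rw [finrank_euclideanSpace_fin, show π / (1 / 2) = 2 * π by ring,
    ← Real.rpow_add (by positivity)]
  simp

lemma integrable_gaussDens : Integrable (gaussDens (n := n)) := by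
  -- The Bochner integral of a non-integrable function is 0 by convention, so the value 1 forces
  -- integrability.
  by_contra h
  have := integral_gaussDens (n := n)
  rw [integral_undef h] at this
  norm_num at this

lemma lintegral_gaussDens : ∫⁻ v : E n, ENNReal.ofReal (gaussDens v) = 1 := by
  rw [← ofReal_integral_eq_lintegral_ofReal integrable_gaussDens
    (ae_of_all _ fun v => (gaussDens_pos v).le), integral_gaussDens, ENNReal.ofReal_one]

lemma stdGaussian_eq_withDensity :
    stdGaussian (E n) = volume.withDensity fun v => ENNReal.ofReal (gaussDens v) := by
  have : IsProbabilityMeasure ((volume : Measure (E n)).withDensity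
      fun v => ENNReal.ofReal (gaussDens v)) := by
    constructor
    rw [withDensity_apply _ MeasurableSet.univ, Measure.restrict_univ, lintegral_gaussDens]
  refine Measure.ext_of_charFun ?_
  ext t
  rw [charFun_stdGaussian, charFun_apply,
    integral_withDensity_eq_integral_toReal_smul measurable_gaussDens.ennreal_ofReal
      (by simp)]
  have h := GaussianFourier.integral_cexp_neg_mul_sq_norm_add (b := 1 / 2) (by norm_num)
    Complex.I t
  have h2 : ∀ v : E n, (ENNReal.ofReal (gaussDens v)).toReal • Complex.exp (⟪v, t⟫ * Complex.I)
      = (((2 * π) ^ (-(n / 2 : ℝ)) : ℝ) : ℂ)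
        * Complex.exp (-(1 / 2) * ‖v‖ ^ 2 + Complex.I * ⟪t, v⟫) := by
    intro v
    rw [ENNReal.toReal_ofReal (gaussDens_pos v).le, gaussDens, Complex.exp_add,
      real_inner_comm, mul_comm Complex.I]
    simp
    ring
  simp_rw [h2]
  rw [integral_const_mul, h, ← mul_assoc, finrank_euclideanSpace_fin]
  have h3 : (((2 * π) ^ (-(n / 2 : ℝ)) : ℝ) : ℂ) * ((π : ℂ) / (1 / 2)) ^ ((n : ℂ) / 2) = 1 := by
    rw [show (π : ℂ) / (1 / 2) = ((2 * π : ℝ) : ℂ) by push_cast; ring,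
      show (n : ℂ) / 2 = ((n / 2 : ℝ) : ℂ) by push_cast; ring,
      ← Complex.ofReal_cpow (by positivity), ← Complex.ofReal_mul, ← Real.rpow_add (by positivity)]
    simp
  rw [h3, one_mul]
  congr 1
  simp
  ring

/-! ### Conditional expectations and independence -/

/-- Conditioning on an additional independent variable does not change the conditional mean. -/
lemma condMean_prodMk_of_indepFun {F G : Type*} [MeasurableSpace F] [MeasurableSpace G]
    {P : Measure Ω} [IsProbabilityMeasure P] {X : Ω → E n} {Y : Ω → F} {W : Ω → G}
    (hX : Measurable X) (hY : Measurable Y) (hW : Measurable W) (hXi : Integrable X P)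
    (h : IndepFun (fun ω => (X ω, Y ω)) W P) :
    condMean P X (fun ω => (Y ω, W ω)) =ᵐ[P] condMean P X Y := by
  -- Fubini over `W`: for fixed `w` the inner domain is an event of `σ(Y)`. The formula is used for
  -- `X` and for its conditional mean, whose integrals agree on each such slice.
  have key : ∀ V : Ω → E n, Measurable V → Integrable V P →
      IndepFun (fun ω => (V ω, Y ω)) W P → ∀ T : Set (F × G), MeasurableSet T →
      ∫ ω in (fun ω => (Y ω, W ω)) ⁻¹' T, V ω ∂P
        = ∫ w, ∫ ω in Y ⁻¹' {y | (y, w) ∈ T}, V ω ∂P ∂(P.map W) := by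
    intro V hV hVi hind T hT
    have hVY : Measurable fun ω => (V ω, Y ω) := hV.prodMk hY
    have hmap := (indepFun_iff_map_prod_eq_prod_map_map hVY.aemeasurable hW.aemeasurable).1 hind
    have hprob : IsProbabilityMeasure (P.map W) := P.isProbabilityMeasure_map hW.aemeasurable
    have hprob2 : IsProbabilityMeasure (P.map fun ω => (V ω, Y ω)) :=
      P.isProbabilityMeasure_map hVY.aemeasurable
    set T' : Set ((E n × F) × G) := {q | (q.1.2, q.2) ∈ T} with hT'
    have hT'm : MeasurableSet T' := (measurable_fst.snd.prodMk measurable_snd) hT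
    set h : (E n × F) × G → E n := T'.indicator fun q => q.1.1 with hh
    have hhm : Measurable h := measurable_fst.fst.indicator hT'm
    have e1 : ∫ ω in (fun ω => (Y ω, W ω)) ⁻¹' T, V ω ∂P
        = ∫ q, h q ∂(P.map fun ω => ((V ω, Y ω), W ω)) := by
      rw [integral_map (hVY.prodMk hW).aemeasurable hhm.aestronglyMeasurable,
        ← integral_indicator ((hY.prodMk hW) hT)]
      rfl
    have hint : Integrable h (P.map fun ω => ((V ω, Y ω), W ω)) := by
      rw [integrable_map_measure hhm.aestronglyMeasurable (hVY.prodMk hW).aemeasurable]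
      have : h ∘ (fun ω => ((V ω, Y ω), W ω))
          = ((fun ω => (Y ω, W ω)) ⁻¹' T).indicator V := rfl
      rw [this]
      exact hVi.indicator ((hY.prodMk hW) hT)
    rw [e1, hmap, integral_prod_symm _ (hmap ▸ hint)]
    refine integral_congr_ae (ae_of_all _ fun w => ?_)
    have hTw : MeasurableSet {y | (y, w) ∈ T} := (measurable_id.prodMk measurable_const) hT
    have hm : Measurable fun q : E n × F => h (q, w) :=
      hhm.comp (measurable_id.prodMk measurable_const)
    change ∫ q, h (q, w) ∂_ = ∫ ω in Y ⁻¹' {y | (y, w) ∈ T}, V ω ∂P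
    rw [integral_map hVY.aemeasurable hm.aestronglyMeasurable, ← integral_indicator (hY hTw)]
    rfl
  have hYc : MeasurableSpace.comap Y inferInstance ≤ mΩ := hY.comap_le
  have hYW : MeasurableSpace.comap (fun ω => (Y ω, W ω)) inferInstance ≤ mΩ :=
    (hY.prodMk hW).comap_le
  have hsm : StronglyMeasurable[MeasurableSpace.comap Y inferInstance] (condMean P X Y) :=
    stronglyMeasurable_condExp
  have hle : MeasurableSpace.comap Y inferInstance
      ≤ MeasurableSpace.comap (fun ω => (Y ω, W ω)) inferInstance :=
    (measurable_fst.comp (comap_measurable fun ω => (Y ω, W ω))).comap_le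
  have hcint : Integrable (condMean P X Y) P := integrable_condExp
  refine (ae_eq_condExp_of_forall_setIntegral_eq hYW hXi (fun s _ _ => hcint.integrableOn) ?_
    (hsm.mono hle).aestronglyMeasurable).symm
  rintro s ⟨T, hT, rfl⟩ -
  -- The conditional mean is a Borel function `c` of `Y`, so it inherits the independence from `W`.
  obtain ⟨c, hc, hc'⟩ := hsm.measurable.exists_eq_measurable_comp
  have hind : IndepFun (fun ω => (condMean P X Y ω, Y ω)) W P := by
    have := h.comp (φ := fun q : E n × F => (c q.2, q.2)) (ψ := id)
      ((hc.comp measurable_snd).prodMk measurable_snd) measurable_id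
    rw [hc']
    exact this
  rw [key _ (hsm.mono hYc).measurable hcint hind T hT, key X hX hXi h T hT]
  refine integral_congr_ae (ae_of_all _ fun w => ?_)
  exact setIntegral_condExp hYc hXi
    ⟨_, (measurable_id.prodMk measurable_const : Measurable fun y : F => (y, w)) hT, rfl⟩

/-! ### The output of a Gaussian channel -/

/-- The density at `y` of `s X + Z`, with `X ∼ μ` and `Z` standard Gaussian. -/
noncomputable def outDens (μ : Measure (E n)) (s : ℝ) (y : E n) : ℝ := ∫ x, gaussDens (y - s • x) ∂μ

/-- The integral of the input against its joint density with the output `y`. -/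
noncomputable def outNum (μ : Measure (E n)) (s : ℝ) (y : E n) : E n :=
  ∫ x, gaussDens (y - s • x) • x ∂μ

/-- The posterior mean of the input `X ∼ μ` given `s X + Z = y`. -/
noncomputable def postMean (μ : Measure (E n)) (s : ℝ) (y : E n) : E n :=
  (outDens μ s y)⁻¹ • outNum μ s y

/-! ### Smoothness of the output density and of the posterior mean -/

section kernel

variable {μ : Measure (E n)} {s : ℝ}

lemma integrable_gaussDens_sub [IsFiniteMeasure μ] (y : E n) :
    Integrable (fun x => gaussDens (y - s • x)) μ := by
  refine Integrable.of_bound (C := (2 * π) ^ (-(n / 2 : ℝ))) ?_ (ae_of_all _ fun x => ?_)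
  · exact (continuous_gaussDens.comp (by fun_prop)).aestronglyMeasurable
  · rw [Real.norm_of_nonneg (gaussDens_pos _).le]
    exact gaussDens_le _

lemma integrable_gaussDens_sub_smul (hμ : Integrable id μ) (y : E n) :
    Integrable (fun x => gaussDens (y - s • x) • x) μ := by
  refine hμ.bdd_smul (φ := fun x => gaussDens (y - s • x)) ((2 * π) ^ (-(n / 2 : ℝ))) ?_ (ae_of_all
    _ fun x => ?_)
  · exact (continuous_gaussDens.comp (by fun_prop)).aestronglyMeasurable
  · rw [Real.norm_of_nonneg (gaussDens_pos _).le]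
    exact gaussDens_le _

lemma outDens_pos [IsProbabilityMeasure μ] (y : E n) : 0 < outDens μ s y := by
  unfold outDens
  rw [integral_pos_iff_support_of_nonneg (fun x => (gaussDens_pos _).le)
    (integrable_gaussDens_sub y)]
  have : Function.support (fun x => gaussDens (y - s • x)) = Set.univ :=
    Set.eq_univ_of_forall fun x => (gaussDens_pos _).ne'
  simp [this]

lemma continuous_outNum (hμ : Integrable id μ) : Continuous (outNum μ s) := by
  unfold outNum
  refine continuous_of_dominated (bound := fun x => (2 * π) ^ (-(n / 2 : ℝ)) * ‖x‖)
    (fun y => (integrable_gaussDens_sub_smul hμ y).aestronglyMeasurable)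
    (fun y => ae_of_all _ fun x => ?_) (hμ.norm.const_mul _) (ae_of_all _ fun x => ?_)
  · rw [norm_smul, Real.norm_of_nonneg (gaussDens_pos _).le]
    gcongr
    exact gaussDens_le _
  · exact (continuous_gaussDens.comp (by fun_prop)).smul continuous_const

/-- Differentiation under the integral. The Gaussian factor contributes `-(y - s x)`, which splits
into an input part, integrating to `outNum`, and a part proportional to `y`. -/
lemma hasFDerivAt_outDens [IsProbabilityMeasure μ] (hμ : Integrable id μ) (y : E n) :
    HasFDerivAt (outDens μ s) (innerSL ℝ (s • outNum μ s y - outDens μ s y • y)) y := by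
  have h := hasFDerivAt_integral_of_dominated_of_fderiv_le (𝕜 := ℝ) (μ := μ)
    (F := fun (y x : E n) => gaussDens (y - s • x))
    (F' := fun y x => -(gaussDens (y - s • x)) • innerSL ℝ (y - s • x))
    (bound := fun _ => (2 * π) ^ (-(n / 2 : ℝ))) (x₀ := y) (s := Set.univ)
    Filter.univ_mem
    (Filter.Eventually.of_forall fun y => (integrable_gaussDens_sub y).aestronglyMeasurable)
    (integrable_gaussDens_sub y) ?_ (ae_of_all _ fun x y' _ => ?_) (integrable_const _)
    (ae_of_all _ fun x y' _ => ?_)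
  · refine h.congr_fderiv ?_
    have e : ∀ x, -(gaussDens (y - s • x)) • innerSL ℝ (y - s • x)
        = innerSL ℝ (s • (gaussDens (y - s • x) • x) - gaussDens (y - s • x) • y) := by
      intro x
      ext w
      simp
      ring
    simp_rw [e]
    have hi1 : Integrable (fun x => s • (gaussDens (y - s • x) • x)) μ :=
      (integrable_gaussDens_sub_smul (s := s) hμ y).smul s
    have hi2 := (integrable_gaussDens_sub (μ := μ) (s := s) y).smul_const y
    refine (ContinuousLinearMap.integral_comp_comm (innerSL ℝ) (hi1.sub hi2)).trans ?_
    congr 1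
    rw [integral_sub' hi1 hi2, integral_smul, integral_smul_const]
    rfl
  · refine Continuous.aestronglyMeasurable ?_
    exact ((continuous_gaussDens.comp (by fun_prop)).neg).smul
      ((innerSL ℝ).continuous.comp (by fun_prop))
  · rw [norm_smul, norm_neg, Real.norm_of_nonneg (gaussDens_pos _).le, innerSL_apply_norm, mul_comm]
    exact norm_mul_gaussDens_le _
  · have := (hasFDerivAt_gaussDens (y' - s • x)).comp y' ((hasFDerivAt_id y').sub_const (s • x))
    simpa [Function.comp_def] using this

lemma continuous_outDens [IsProbabilityMeasure μ] (hμ : Integrable id μ) :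
    Continuous (outDens μ s) :=
  continuous_iff_continuousAt.2 fun y => (hasFDerivAt_outDens hμ y).continuousAt

lemma continuous_postMean [IsProbabilityMeasure μ] (hμ : Integrable id μ) :
    Continuous (postMean μ s) :=
  ((continuous_outDens hμ).inv₀ fun y => (outDens_pos y).ne').smul (continuous_outNum hμ)

/-- Conditional means are fixed only up to a null set for each `γ` separately; joint measurability
in gain and output makes the integrand of the deficit measurable in `γ`. -/
lemma measurable_uncurry_postMean (μ : Measure (E n)) [SFinite μ] :
    Measurable fun q : ℝ × E n => postMean μ q.1 q.2 := by
  have h1 : StronglyMeasurable fun q : ℝ × E n => outDens μ q.1 q.2 :=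
    StronglyMeasurable.integral_prod_right' (f := fun r : (ℝ × E n) × E n =>
      gaussDens (r.1.2 - r.1.1 • r.2))
      (continuous_gaussDens.comp (by fun_prop)).stronglyMeasurable
  have h2 : StronglyMeasurable fun q : ℝ × E n => outNum μ q.1 q.2 :=
    StronglyMeasurable.integral_prod_right' (f := fun r : (ℝ × E n) × E n =>
      gaussDens (r.1.2 - r.1.1 • r.2) • r.2)
      ((continuous_gaussDens.comp (by fun_prop)).smul continuous_snd).stronglyMeasurable
  exact h1.measurable.inv.smul h2.measurable

/-- Tweedie's formula: divide the gradient of the density by the density. -/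
lemma gradient_log_outDens [IsProbabilityMeasure μ] (hμ : Integrable id μ) (y : E n) :
    ∇ (fun y => Real.log (outDens μ s y)) y = s • postMean μ s y - y := by
  refine HasGradientAt.gradient ?_
  rw [hasGradientAt_iff_hasFDerivAt]
  refine ((hasFDerivAt_outDens hμ y).log (outDens_pos y).ne').congr_fderiv ?_
  ext w
  have := (outDens_pos (μ := μ) (s := s) y).ne'
  simp [postMean]
  field_simp

end kernel

/-! ### Law, score and conditional mean of the channel output -/

section channel

variable {P : Measure Ω} {X Z : Ω → E n} {γ : ℝ}

lemma measurable_chan (γ : ℝ) (hX : Measurable X) (hZ : Measurable Z) : Measurable (chan γ X Z)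
    := by
  unfold chan; fun_prop

/-- For fixed `x`, the output is a translate of the noise, and Lebesgue measure is translation
invariant. -/
lemma map_prodMk_chan [IsProbabilityMeasure P] (hX : Measurable X) (hZ : Measurable Z)
    (hXZ : IndepFun X Z P)
    (hZl : HasLaw Z (stdGaussian (E n)) P) :
    P.map (fun ω => (X ω, chan γ X Z ω)) = ((P.map X).prod volume).withDensity
      fun q => ENNReal.ofReal (gaussDens (q.2 - √γ • q.1)) := by
  have hμ : IsProbabilityMeasure (P.map X) := P.isProbabilityMeasure_map hX.aemeasurable
  have hmap := (indepFun_iff_map_prod_eq_prod_map_map hX.aemeasurable hZ.aemeasurable).1 hXZ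
  have hT : Measurable fun q : E n × E n => (q.1, √γ • q.1 + q.2) := by fun_prop
  have e : (fun ω => (X ω, chan γ X Z ω))
      = (fun q : E n × E n => (q.1, √γ • q.1 + q.2)) ∘ fun ω => (X ω, Z ω) := rfl
  have hd : Measurable fun q : E n × E n => ENNReal.ofReal (gaussDens (q.2 - √γ • q.1)) :=
    (measurable_gaussDens.comp (by fun_prop)).ennreal_ofReal
  rw [e, ← Measure.map_map hT (hX.prodMk hZ), hmap, hZl.map_eq]
  ext S hS
  rw [Measure.map_apply hT hS, Measure.prod_apply (hT hS), withDensity_apply _ hS,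
    ← lintegral_indicator hS, lintegral_prod _ (hd.indicator hS).aemeasurable]
  refine lintegral_congr fun x => ?_
  have hS' : MeasurableSet (Prod.mk x ⁻¹' ((fun q : E n × E n => (q.1, √γ • q.1 + q.2)) ⁻¹' S)) :=
    measurable_prodMk_left (hT hS)
  rw [stdGaussian_eq_withDensity, withDensity_apply _ hS', ← lintegral_indicator hS',
    ← lintegral_add_left_eq_self (fun y => S.indicator _ (x, y)) (√γ • x)]
  refine lintegral_congr fun z => ?_
  by_cases hz : (x, √γ • x + z) ∈ S <;> simp [Set.indicator, hz]

lemma integrable_id_map (hX : Measurable X) (hXi : Integrable X P) :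
    Integrable id (P.map X) :=
  (integrable_map_measure measurable_id.aestronglyMeasurable hX.aemeasurable).2 hXi

lemma isContDensity_chan [IsProbabilityMeasure P] (hX : Measurable X) (hZ : Measurable Z)
    (hXi : Integrable X P)
    (hXZ : IndepFun X Z P) (hZl : HasLaw Z (stdGaussian (E n)) P) :
    IsContDensity (chan γ X Z) P (outDens (P.map X) √γ) := by
  have hμ : IsProbabilityMeasure (P.map X) := P.isProbabilityMeasure_map hX.aemeasurable
  refine ⟨continuous_outDens (integrable_id_map hX hXi), fun y => (outDens_pos y).le, ?_⟩
  have hd : Measurable fun q : E n × E n => ENNReal.ofReal (gaussDens (q.2 - √γ • q.1)) :=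
    (measurable_gaussDens.comp (by fun_prop)).ennreal_ofReal
  have e : chan γ X Z = Prod.snd ∘ fun ω => (X ω, chan γ X Z ω) := rfl
  conv_lhs => rw [e, ← Measure.map_map measurable_snd (hX.prodMk (measurable_chan γ hX hZ)),
    map_prodMk_chan hX hZ hXZ hZl]
  ext S hS
  rw [Measure.map_apply measurable_snd hS, withDensity_apply _ (measurable_snd hS),
    withDensity_apply _ hS, ← Set.univ_prod, ← Measure.prod_restrict, Measure.restrict_univ,
    lintegral_prod_symm _ hd.aemeasurable]
  refine lintegral_congr fun y => ?_
  exact (ofReal_integral_eq_lintegral_ofReal (integrable_gaussDens_sub y)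
    (ae_of_all _ fun x => (gaussDens_pos _).le)).symm

/-- Full support turns almost sure identities between continuous functions of the output into
identities everywhere. -/
lemma isOpenPosMeasure_map_chan [IsProbabilityMeasure P] (hX : Measurable X) (hZ : Measurable Z)
    (hXi : Integrable X P)
    (hXZ : IndepFun X Z P) (hZl : HasLaw Z (stdGaussian (E n)) P) :
    (P.map (chan γ X Z)).IsOpenPosMeasure := by
  have hμ : IsProbabilityMeasure (P.map X) := P.isProbabilityMeasure_map hX.aemeasurable
  have h := isContDensity_chan (γ := γ) hX hZ hXi hXZ hZl
  rw [h.map_eq]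
  refine Measure.AbsolutelyContinuous.isOpenPosMeasure (μ := volume)
    (withDensity_absolutelyContinuous' h.continuous.measurable.ennreal_ofReal.aemeasurable
      (ae_of_all _ fun y => ?_))
  simpa using outDens_pos y

lemma score_chan [IsProbabilityMeasure P] (hX : Measurable X) (hZ : Measurable Z)
    (hXi : Integrable X P)
    (hXZ : IndepFun X Z P) (hZl : HasLaw Z (stdGaussian (E n)) P) (y : E n) :
    score (chan γ X Z) P y = √γ • postMean (P.map X) √γ y - y := by
  have hμ : IsProbabilityMeasure (P.map X) := P.isProbabilityMeasure_map hX.aemeasurable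
  rw [score, (isContDensity_chan hX hZ hXi hXZ hZl).density_eq,
    gradient_log_outDens (integrable_id_map hX hXi)]

/-- Bayes' rule: over an event `Y ∈ A`, both `X` and the posterior mean integrate to the Lebesgue
integral of `outNum` over `A`. -/
lemma condMean_chan [IsProbabilityMeasure P] (hX : Measurable X) (hZ : Measurable Z)
    (hXi : Integrable X P)
    (hXZ : IndepFun X Z P) (hZl : HasLaw Z (stdGaussian (E n)) P) :
    condMean P X (chan γ X Z) =ᵐ[P] fun ω => postMean (P.map X) √γ (chan γ X Z ω) := by
  have hμ : IsProbabilityMeasure (P.map X) := P.isProbabilityMeasure_map hX.aemeasurable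
  set μ := P.map X with hμd
  set g := postMean μ √γ with hg
  have hμi : Integrable id μ := integrable_id_map hX hXi
  have hY := measurable_chan γ hX hZ
  have hgc : Continuous g := continuous_postMean hμi
  have hdens := isContDensity_chan (γ := γ) hX hZ hXi hXZ hZl
  have hd : Measurable fun q : E n × E n => ENNReal.ofReal (gaussDens (q.2 - √γ • q.1)) :=
    (measurable_gaussDens.comp (by fun_prop)).ennreal_ofReal
  have hdm : Measurable fun y => ENNReal.ofReal (outDens μ √γ y) :=
    hdens.continuous.measurable.ennreal_ofReal
  -- Integrability of `X`, rewritten through the joint density; it justifies Fubini and the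
  -- integrability of `g`.
  have hjoint : Integrable (fun q : E n × E n => gaussDens (q.2 - √γ • q.1) • q.1)
      (μ.prod volume) := by
    have h1 : Integrable (fun q : E n × E n => q.1) (P.map fun ω => (X ω, chan γ X Z ω)) := by
      rw [integrable_map_measure measurable_fst.aestronglyMeasurable (hX.prodMk hY).aemeasurable]
      exact hXi
    rw [map_prodMk_chan hX hZ hXZ hZl,
      integrable_withDensity_iff_integrable_smul' hd (by simp)] at h1
    refine h1.congr (ae_of_all _ fun q => ?_)
    simp [ENNReal.toReal_ofReal (gaussDens_pos _).le]
  have hfg : ∀ y, outDens μ √γ y • g y = outNum μ √γ y := fun y => by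
    rw [hg, postMean, smul_smul, mul_inv_cancel₀ (outDens_pos y).ne', one_smul]
  have hgi : Integrable g (P.map (chan γ X Z)) := by
    rw [hdens.map_eq, integrable_withDensity_iff_integrable_smul' hdm (by simp)]
    refine hjoint.integral_prod_right.congr (ae_of_all _ fun y => ?_)
    simp only [ENNReal.toReal_ofReal (outDens_pos (μ := μ) y).le]
    exact (hfg y).symm
  have hgi' : Integrable (fun ω => g (chan γ X Z ω)) P :=
    (integrable_map_measure hgc.aestronglyMeasurable hY.aemeasurable).1 hgi
  refine (ae_eq_condExp_of_forall_setIntegral_eq hY.comap_le hXi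
    (fun s _ _ => hgi'.integrableOn) ?_ ?_).symm
  · rintro s ⟨A, hA, rfl⟩ -
    have e1 : ∫ ω in chan γ X Z ⁻¹' A, g (chan γ X Z ω) ∂P = ∫ y in A, outNum μ √γ y := by
      rw [← setIntegral_map hA hgc.aestronglyMeasurable hY.aemeasurable, hdens.map_eq,
        setIntegral_withDensity_eq_setIntegral_toReal_smul hdm (by simp) _ hA]
      refine integral_congr_ae (ae_of_all _ fun y => ?_)
      simp only [ENNReal.toReal_ofReal (outDens_pos (μ := μ) y).le]
      exact hfg y
    have e2 : ∫ ω in chan γ X Z ⁻¹' A, X ω ∂P = ∫ y in A, outNum μ √γ y := by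
      have e3 : ∫ ω in chan γ X Z ⁻¹' A, X ω ∂P
          = ∫ q in Prod.snd ⁻¹' A, q.1 ∂(P.map fun ω => (X ω, chan γ X Z ω)) := by
        rw [setIntegral_map (measurable_snd hA) measurable_fst.aestronglyMeasurable
          (hX.prodMk hY).aemeasurable]
        rfl
      rw [e3, map_prodMk_chan hX hZ hXZ hZl,
        setIntegral_withDensity_eq_setIntegral_toReal_smul hd (by simp) _ (measurable_snd hA),
        ← Set.univ_prod, ← Measure.prod_restrict, Measure.restrict_univ]
      simp only [ENNReal.toReal_ofReal (gaussDens_pos _).le]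
      rw [integral_prod_symm]
      · rfl
      · have := hjoint.restrict (s := Set.univ ×ˢ A)
        rwa [← Measure.prod_restrict, Measure.restrict_univ] at this
    rw [e1, e2]
  · exact (hgc.measurable.comp (comap_measurable _)).stronglyMeasurable.aestronglyMeasurable

end channel

/-! ### An affine posterior mean forces a Gaussian input -/

/-! ### Derivatives of characteristic functions -/

section charFun

variable {P : Measure Ω} {X Z : Ω → E n}

lemma integrable_cexp_mul_I [IsProbabilityMeasure P] {f : Ω → ℝ} (hf : Measurable f) :
    Integrable (fun ω => Complex.exp (f ω * Complex.I)) P := by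
  refine Integrable.of_bound (C := 1) ?_ (ae_of_all _ fun _ => (Complex.norm_exp_ofReal_mul_I _).le)
  exact (by fun_prop : Measurable _).aestronglyMeasurable

lemma integrable_mul_cexp_mul_I [IsProbabilityMeasure P] {f g : Ω → ℝ} (hf : Measurable f)
    (hg : Integrable g P) :
    Integrable (fun ω => (g ω : ℂ) * Complex.exp (f ω * Complex.I)) P :=
  hg.ofReal.mul_bdd (c := 1) (integrable_cexp_mul_I hf).aestronglyMeasurable
    (ae_of_all _ fun _ => (Complex.norm_exp_ofReal_mul_I _).le)

/-- The derivative of the characteristic function along a line. -/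
lemma hasDerivAt_integral_cexp [IsProbabilityMeasure P] {f g : Ω → ℝ} (hf : Measurable f)
    (hg : Measurable g)
    (hgi : Integrable g P) (r : ℝ) :
    HasDerivAt (fun r : ℝ => ∫ ω, Complex.exp ((f ω + r * g ω : ℝ) * Complex.I) ∂P)
      (Complex.I * ∫ ω, (g ω : ℂ) * Complex.exp ((f ω + r * g ω : ℝ) * Complex.I) ∂P) r := by
  have h := (hasDerivAt_integral_of_dominated_loc_of_deriv_le (𝕜 := ℝ) (μ := P)
    (F := fun (r : ℝ) ω => Complex.exp ((f ω + r * g ω : ℝ) * Complex.I))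
    (F' := fun (r : ℝ) ω => Complex.I * ((g ω : ℂ) * Complex.exp ((f ω + r * g ω : ℝ) * Complex.I)))
    (bound := fun ω => ‖g ω‖) (x₀ := r) (s := Set.univ) Filter.univ_mem
    (Filter.Eventually.of_forall fun r =>
      (integrable_cexp_mul_I (by fun_prop)).aestronglyMeasurable)
    (integrable_cexp_mul_I (by fun_prop))
    ((integrable_mul_cexp_mul_I (by fun_prop) hgi).const_mul _).aestronglyMeasurable
    (ae_of_all _ fun ω r _ => ?_) hgi.norm (ae_of_all _ fun ω r _ => ?_)).2
  · rwa [integral_const_mul] at h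
  · rw [norm_mul, norm_mul, Complex.norm_exp_ofReal_mul_I]
    simp
  · have h1 : HasDerivAt (fun r : ℝ => f ω + r * g ω) (g ω) r := by
      simpa using ((hasDerivAt_id r).mul_const (g ω)).const_add (f ω)
    have h2 := (h1.ofReal_comp.mul_const Complex.I).cexp
    refine h2.congr_deriv ?_
    ring

lemma integral_cexp_inner_stdGaussian (hZ : Measurable Z) (hZl : HasLaw Z (stdGaussian (E n)) P)
    (t : E n) : ∫ ω, Complex.exp ((⟪t, Z ω⟫ : ℝ) * Complex.I) ∂P
      = Complex.exp (-‖t‖ ^ 2 / 2) := by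
  rw [← charFun_stdGaussian, ← hZl.map_eq, charFun_apply, integral_map hZ.aemeasurable
    (by fun_prop)]
  simp_rw [real_inner_comm]

lemma integrable_of_hasLaw_stdGaussian (hZl : HasLaw Z (stdGaussian (E n)) P) :
    Integrable Z P := hZl.hasGaussianLaw.integrable

/-- Differentiate the Gaussian characteristic function at `t + r v` with respect to `r` at `r = 0`.
-/
lemma integral_inner_mul_cexp_stdGaussian [IsProbabilityMeasure P] (hZ : Measurable Z)
    (hZl : HasLaw Z (stdGaussian (E n)) P) (v t : E n) :
    ∫ ω, (⟪v, Z ω⟫ : ℂ) * Complex.exp ((⟪t, Z ω⟫ : ℝ) * Complex.I) ∂P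
      = Complex.I * ⟪v, t⟫ * Complex.exp (-‖t‖ ^ 2 / 2) := by
  have hZi := integrable_of_hasLaw_stdGaussian hZl
  have h1 := hasDerivAt_integral_cexp (P := P) (f := fun ω => ⟪t, Z ω⟫) (g := fun ω => ⟪v, Z ω⟫)
    (by fun_prop) (by fun_prop) (hZi.const_inner v) 0
  have e : ∀ r : ℝ, ∫ ω, Complex.exp ((⟪t, Z ω⟫ + r * ⟪v, Z ω⟫ : ℝ) * Complex.I) ∂P
      = Complex.exp ((-‖t + r • v‖ ^ 2 / 2 : ℝ)) := by
    intro r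
    have := integral_cexp_inner_stdGaussian hZ hZl (t + r • v)
    simp_rw [inner_add_left, real_inner_smul_left] at this
    rw [this]
    push_cast
    rfl
  simp_rw [e] at h1
  have h2 : HasDerivAt (fun r : ℝ => -‖t + r • v‖ ^ 2 / 2) (-⟪v, t⟫) 0 := by
    have h3 : HasDerivAt (fun r : ℝ => t + r • v) v 0 := by
      simpa using ((hasDerivAt_id (0 : ℝ)).smul_const v).const_add t
    have h4 := (h3.norm_sq.neg).div_const 2
    refine h4.congr_deriv ?_
    rw [zero_smul, add_zero, real_inner_comm]
    ring
  have h5 := h1.unique h2.ofReal_comp.cexp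
  simp only [zero_smul, add_zero, zero_mul] at h5
  have h6 := congrArg (fun z => -Complex.I * z) h5
  simp only [← mul_assoc, neg_mul, Complex.I_mul_I, neg_neg, one_mul] at h6
  rw [h6]
  push_cast
  ring

end charFun

/-! ### The differential equation for the input's characteristic function -/

section affine

variable {P : Measure Ω} {X Z : Ω → E n} {γ : ℝ}

/-- The relation between the characteristic function of the input and its derivative when the
posterior mean is affine. -/
lemma integral_inner_mul_cexp_of_condMean_affine [IsProbabilityMeasure P] (hX : Measurable X)
    (hZ : Measurable Z)
    (hXi : Integrable X P) (hXZ : IndepFun X Z P) (hZl : HasLaw Z (stdGaussian (E n)) P)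
    {A : E n →L[ℝ] E n} {c : E n}
    (h : condMean P X (chan γ X Z) =ᵐ[P] fun ω => A (chan γ X Z ω) + c) (w t : E n) :
    ∫ ω, (⟪w - √γ • A.adjoint w, X ω⟫ : ℂ) * Complex.exp ((√γ * ⟪t, X ω⟫ : ℝ) * Complex.I) ∂P
      = (Complex.I * ⟪A.adjoint w, t⟫ + ⟪w, c⟫)
        * ∫ ω, Complex.exp ((√γ * ⟪t, X ω⟫ : ℝ) * Complex.I) ∂P := by
  set Y := chan γ X Z with hYd
  have hY : Measurable Y := measurable_chan γ hX hZ
  have hZi := integrable_of_hasLaw_stdGaussian hZl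
  have hYi : Integrable Y P := (hXi.smul √γ).add hZi
  set e : Ω → ℂ := fun ω => Complex.exp ((⟪t, Y ω⟫ : ℝ) * Complex.I) with he
  set eX : Ω → ℂ := fun ω => Complex.exp ((√γ * ⟪t, X ω⟫ : ℝ) * Complex.I) with heX
  set eZ : Ω → ℂ := fun ω => Complex.exp ((⟪t, Z ω⟫ : ℝ) * Complex.I) with heZ
  have hee : ∀ ω, e ω = eX ω * eZ ω := fun ω => by
    simp only [he, heX, heZ, hYd, chan]
    rw [← Complex.exp_add, inner_add_right, real_inner_smul_right]
    push_cast
    ring_nf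
  -- The factor `e` is a bounded function of `Y`, so it can be pulled out of the conditional
  -- expectation.
  have k1 : ∫ ω, (⟪w, X ω⟫ : ℂ) * e ω ∂P = ∫ ω, (⟪w, A (Y ω) + c⟫ : ℂ) * e ω ∂P := by
    have hm : MeasurableSpace.comap Y inferInstance ≤ mΩ := hY.comap_le
    let B : E n →L[ℝ] ℂ →L[ℝ] ℂ :=
      (ContinuousLinearMap.mul ℝ ℂ).comp (Complex.ofRealCLM.comp (innerSL ℝ w))
    have hpull := condExp_bilin_of_stronglyMeasurable_right (μ := P) B (f := X) (g := e)
      (m := MeasurableSpace.comap Y inferInstance) ?_ ?_ hXi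
    · rw [← integral_condExp hm (f := fun ω => (⟪w, X ω⟫ : ℂ) * e ω)]
      refine integral_congr_ae (hpull.trans ?_)
      filter_upwards [h] with ω hω
      rw [condMean] at hω
      rw [hω]
      rfl
    · refine Measurable.stronglyMeasurable ?_
      have : Measurable fun y : E n => Complex.exp ((⟪t, y⟫ : ℝ) * Complex.I) := by fun_prop
      exact this.comp (comap_measurable Y)
    · exact integrable_mul_cexp_mul_I (by fun_prop) (hXi.const_inner w)
  have iX : ∀ v : E n, Integrable (fun ω => (⟪v, X ω⟫ : ℂ) * e ω) P := fun v =>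
    integrable_mul_cexp_mul_I (by fun_prop) (hXi.const_inner v)
  have iZ : ∀ v : E n, Integrable (fun ω => (⟪v, Z ω⟫ : ℂ) * e ω) P := fun v =>
    integrable_mul_cexp_mul_I (by fun_prop) (hZi.const_inner v)
  have ie : Integrable e P := integrable_cexp_mul_I (by fun_prop)
  have k2 : ∫ ω, (⟪w - √γ • A.adjoint w, X ω⟫ : ℂ) * e ω ∂P
      = ∫ ω, (⟪A.adjoint w, Z ω⟫ : ℂ) * e ω ∂P + ⟪w, c⟫ * ∫ ω, e ω ∂P := by
    have r1 : ∀ ω, (⟪w - √γ • A.adjoint w, X ω⟫ : ℂ) * e ω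
        = (⟪w, X ω⟫ : ℂ) * e ω - √γ * ((⟪A.adjoint w, X ω⟫ : ℂ) * e ω) := fun ω => by
      rw [inner_sub_left, real_inner_smul_left]; push_cast; ring
    have r2 : ∀ ω, (⟪w, A (Y ω) + c⟫ : ℂ) * e ω
        = √γ * ((⟪A.adjoint w, X ω⟫ : ℂ) * e ω)
          + ((⟪A.adjoint w, Z ω⟫ : ℂ) * e ω + ⟪w, c⟫ * e ω) := fun ω => by
      rw [inner_add_right, ← ContinuousLinearMap.adjoint_inner_left, hYd, chan, inner_add_right,
        real_inner_smul_right]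
      push_cast; ring
    simp_rw [r1]
    rw [integral_sub (iX w) ((iX _).const_mul _), k1]
    simp_rw [r2]
    have iZc : Integrable (fun ω => (⟪A.adjoint w, Z ω⟫ : ℂ) * e ω + ⟪w, c⟫ * e ω) P :=
      (iZ _).add (ie.const_mul _)
    rw [integral_add ((iX _).const_mul _) iZc,
      integral_add (iZ _) (ie.const_mul _), integral_const_mul _ e]
    ring
  -- Independence of `X` and `Z` factors every expectation; the noise factor never vanishes and is
  -- cancelled at the end.
  have f1 : ∀ v : E n, ∫ ω, (⟪v, X ω⟫ : ℂ) * e ω ∂P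
      = (∫ ω, (⟪v, X ω⟫ : ℂ) * eX ω ∂P) * ∫ ω, eZ ω ∂P := fun v => by
    have hi : IndepFun (fun ω => (⟪v, X ω⟫ : ℂ) * eX ω) eZ P :=
      hXZ.comp (φ := fun x => (⟪v, x⟫ : ℂ) * Complex.exp ((√γ * ⟪t, x⟫ : ℝ) * Complex.I))
        (ψ := fun z => Complex.exp ((⟪t, z⟫ : ℝ) * Complex.I)) (by fun_prop) (by fun_prop)
    rw [← hi.integral_fun_mul_eq_mul_integral
      (by fun_prop) (by fun_prop)]
    simp_rw [hee, mul_assoc]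
  have f2 : ∀ v : E n, ∫ ω, (⟪v, Z ω⟫ : ℂ) * e ω ∂P
      = (∫ ω, eX ω ∂P) * ∫ ω, (⟪v, Z ω⟫ : ℂ) * eZ ω ∂P := fun v => by
    have hi : IndepFun eX (fun ω => (⟪v, Z ω⟫ : ℂ) * eZ ω) P :=
      hXZ.comp (φ := fun x => Complex.exp ((√γ * ⟪t, x⟫ : ℝ) * Complex.I))
        (ψ := fun z => (⟪v, z⟫ : ℂ) * Complex.exp ((⟪t, z⟫ : ℝ) * Complex.I))
        (by fun_prop) (by fun_prop)
    rw [← hi.integral_fun_mul_eq_mul_integral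
      (by fun_prop) (by fun_prop)]
    simp_rw [hee]
    refine integral_congr_ae (ae_of_all _ fun ω => ?_)
    simp only
    ring
  have f3 : ∫ ω, e ω ∂P = (∫ ω, eX ω ∂P) * ∫ ω, eZ ω ∂P := by
    have hi : IndepFun eX eZ P :=
      hXZ.comp (φ := fun x => Complex.exp ((√γ * ⟪t, x⟫ : ℝ) * Complex.I))
        (ψ := fun z => Complex.exp ((⟪t, z⟫ : ℝ) * Complex.I)) (by fun_prop) (by fun_prop)
    rw [← hi.integral_fun_mul_eq_mul_integral (by fun_prop) (by fun_prop)]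
    simp_rw [hee]
  rw [f1, f2, f3, integral_inner_mul_cexp_stdGaussian hZ hZl,
    integral_cexp_inner_stdGaussian hZ hZl] at k2
  refine mul_right_cancel₀ (Complex.exp_ne_zero (-‖t‖ ^ 2 / 2)) (k2.trans ?_)
  ring

/-- In finite dimension injectivity suffices. For `w` in the kernel the left side of the previous
identity vanishes: `t = 0` gives `⟪w, c⟫ = 0`, and a small `t` along `w` gives `⟪A.adjoint w, w⟫ =
0`. Since `w = √γ • A.adjoint w`, this makes `‖w‖² = 0`. -/
lemma exists_sub_smul_adjoint_eq [IsProbabilityMeasure P] (hX : Measurable X) (hZ : Measurable Z)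
    (hXi : Integrable X P) (hXZ : IndepFun X Z P) (hZl : HasLaw Z (stdGaussian (E n)) P)
    {A : E n →L[ℝ] E n} {c : E n}
    (h : condMean P X (chan γ X Z) =ᵐ[P] fun ω => A (chan γ X Z ω) + c) (t : E n) :
    ∃ w : E n, w - √γ • A.adjoint w = t := by
  let T : E n →ₗ[ℝ] E n := LinearMap.id - √γ • (A.adjoint : E n →ₗ[ℝ] E n)
  suffices hT : Function.Injective T from (LinearMap.injective_iff_surjective.1 hT) t
  rw [← LinearMap.ker_eq_bot, LinearMap.ker_eq_bot']
  intro w hw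
  have hw' : w - √γ • A.adjoint w = 0 := hw
  have key := integral_inner_mul_cexp_of_condMean_affine hX hZ hXi hXZ hZl h w
  simp only [hw', inner_zero_left, Complex.ofReal_zero, zero_mul, integral_zero] at key
  have hc : (⟪w, c⟫ : ℂ) = 0 := by simpa using (key 0).symm
  simp only [hc, add_zero] at key
  -- The characteristic function is 1 at the origin, so by continuity it is nonzero at some `r ≠ 0`.
  have hcont := (hasDerivAt_integral_cexp (P := P) (f := fun _ => 0)
    (g := fun ω => √γ * ⟪w, X ω⟫) measurable_const (by fun_prop)
    ((hXi.const_inner w).const_mul _) 0).continuousAt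
  have hne := hcont.eventually_ne (y := 0) (by simp)
  obtain ⟨r, hr, hr0⟩ := ((hne.filter_mono nhdsWithin_le_nhds).and
    (self_mem_nhdsWithin (s := {(0 : ℝ)}ᶜ))).exists
  have k := key (r • w)
  simp only [real_inner_smul_left, mul_left_comm (√γ), zero_add] at k hr
  have k2 := (mul_eq_zero.1 k.symm).resolve_right hr
  have k3 : r * ⟪A.adjoint w, w⟫ = 0 := by
    simpa [real_inner_smul_right] using k2
  have k4 : ⟪A.adjoint w, w⟫ = 0 := (mul_eq_zero.1 k3).resolve_left hr0
  have k5 : ⟪w, w⟫ = 0 := by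
    have : w = √γ • A.adjoint w := sub_eq_zero.1 hw'
    conv_lhs => rw [this]
    rw [← this, this, real_inner_smul_left, ← this, k4, mul_zero]
  exact inner_self_eq_zero.1 k5

/-- Along the line through `t`, the characteristic function solves a linear equation whose solution
is Gaussian. The variance depends only on `A`, `w`, `t` and `γ`; the constant `c` enters only the
mean. -/
lemma map_inner_of_condMean_affine [IsProbabilityMeasure P] (hγ : 0 < γ) (hX : Measurable X)
    (hZ : Measurable Z)
    (hXi : Integrable X P) (hXZ : IndepFun X Z P) (hZl : HasLaw Z (stdGaussian (E n)) P)
    {A : E n →L[ℝ] E n} {c : E n}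
    (h : condMean P X (chan γ X Z) =ᵐ[P] fun ω => A (chan γ X Z ω) + c) {w t : E n}
    (hw : w - √γ • A.adjoint w = t) :
    0 ≤ ⟪A.adjoint w, t⟫ / √γ ∧ P.map (fun ω => ⟪t, X ω⟫)
      = gaussianReal ⟪w, c⟫ (⟪A.adjoint w, t⟫ / √γ).toNNReal := by
  have hs : 0 < √γ := Real.sqrt_pos.2 hγ
  set s := √γ with hsd
  set v := ⟪A.adjoint w, t⟫ with hv
  set m := ⟪w, c⟫ with hm
  set u : ℝ → ℂ := fun r => ∫ ω, Complex.exp ((0 + r * (s * ⟪t, X ω⟫) : ℝ) * Complex.I) ∂P with hu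
  have hderiv : ∀ r : ℝ, HasDerivAt u ((-(s * v * r) + Complex.I * (s * m)) * u r) r := by
    intro r
    have h1 := hasDerivAt_integral_cexp (P := P) (f := fun _ => 0)
      (g := fun ω => s * ⟪t, X ω⟫) measurable_const (by fun_prop)
      ((hXi.const_inner t).const_mul _) r
    refine h1.congr_deriv ?_
    have h2 := integral_inner_mul_cexp_of_condMean_affine hX hZ hXi hXZ hZl h w (r • t)
    rw [hw] at h2
    have e1 : ∀ ω, s * ⟪r • t, X ω⟫ = 0 + r * (s * ⟪t, X ω⟫) := fun ω => by
      rw [real_inner_smul_left]; ring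
    simp_rw [← hsd, e1] at h2
    have e2 : ∀ ω, ((s * ⟪t, X ω⟫ : ℝ) : ℂ)
        * Complex.exp ((0 + r * (s * ⟪t, X ω⟫) : ℝ) * Complex.I)
        = s * ((⟪t, X ω⟫ : ℂ) * Complex.exp ((0 + r * (s * ⟪t, X ω⟫) : ℝ) * Complex.I)) :=
      fun ω => by push_cast; ring
    simp_rw [e2]
    rw [integral_const_mul, h2, real_inner_smul_right, ← hv, ← hm]
    simp only [hu]
    push_cast
    linear_combination (s * r * v * ∫ ω, Complex.exp ((0 + r * (s * (⟪t, X ω⟫ : ℂ))) * Complex.I)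
      ∂P)
      * Complex.I_mul_I
  have hsol : ∀ r : ℝ, u r = Complex.exp (-(s * v * r ^ 2 / 2) + Complex.I * (s * m) * r) := by
    intro r
    -- The quotient of `u` by the expected solution has zero derivative and equals 1 at 0.
    set k : ℝ → ℂ := fun r => u r * Complex.exp (s * v * r ^ 2 / 2 - Complex.I * (s * m) * r)
      with hk
    have hkd : ∀ r, HasDerivAt k 0 r := by
      intro r
      have h1 : HasDerivAt (fun r : ℝ => (r : ℂ)) 1 r := Complex.ofRealCLM.hasDerivAt
      have h2 := ((((h1.pow 2).const_mul (s * v : ℂ)).div_const 2).sub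
        (h1.const_mul (Complex.I * (s * m)))).cexp
      refine ((hderiv r).mul h2).congr_deriv ?_
      simp
      ring
    have hconst := is_const_of_deriv_eq_zero (fun r => (hkd r).differentiableAt)
      (fun r => (hkd r).deriv) r 0
    have hk0 : k 0 = 1 := by simp [hk, hu]
    rw [hk0, hk] at hconst
    simp only at hconst
    rw [eq_comm, ← mul_one (Complex.exp _), ← hconst, mul_comm (u r), ← mul_assoc,
      ← Complex.exp_add]
    ring_nf
    simp
  -- A characteristic function is bounded by 1; at `r = 1` this reads `exp (-(s v / 2)) ≤ 1`.
  have hv0 : 0 ≤ v := by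
    have h1 : ‖u 1‖ ≤ 1 := by
      refine (norm_integral_le_integral_norm _).trans ?_
      simp_rw [Complex.norm_exp_ofReal_mul_I]
      simp
    rw [hsol, Complex.norm_exp, Real.exp_le_one_iff] at h1
    have h2 : -(s * v / 2) ≤ 0 := by
      have : (-((s : ℂ) * v * ((1 : ℝ) : ℂ) ^ 2 / 2) + Complex.I * (s * m) * ((1 : ℝ) : ℂ)).re
          = -(s * v / 2) := by
        have e : (-((s : ℂ) * v * ((1 : ℝ) : ℂ) ^ 2 / 2) + Complex.I * (s * m) * ((1 : ℝ) : ℂ))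
          = ((-(s * v / 2) : ℝ) : ℂ) + ((s * m : ℝ) : ℂ) * Complex.I := by push_cast; ring
        rw [e, Complex.add_re, Complex.re_ofReal_mul, Complex.ofReal_re]
        simp
      rwa [this] at h1
    by_contra hneg
    nlinarith [mul_neg_of_pos_of_neg hs (not_le.1 hneg)]
  have hvs : 0 ≤ v / s := div_nonneg hv0 hs.le
  refine ⟨hvs, ?_⟩
  have hp : IsProbabilityMeasure (P.map fun ω => ⟪t, X ω⟫) :=
    P.isProbabilityMeasure_map (by fun_prop)
  refine Measure.ext_of_charFun ?_
  ext r
  rw [charFun_gaussianReal, charFun_apply_real, integral_map (by fun_prop) (by fun_prop)]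
  have e : ∀ ω, Complex.exp (r * (⟪t, X ω⟫ : ℝ) * Complex.I)
      = Complex.exp ((0 + (r / s) * (s * ⟪t, X ω⟫) : ℝ) * Complex.I) := fun ω => by
    congr 2
    rw [← Complex.ofReal_mul]
    congr 1
    field_simp
    simp
  simp_rw [e]
  rw [show ∫ ω, Complex.exp ((0 + (r / s) * (s * ⟪t, X ω⟫) : ℝ) * Complex.I) ∂P = u (r / s) from
    rfl,
    hsol]
  congr 1
  have hsc : (s : ℂ) ≠ 0 := by exact_mod_cast hs.ne'
  have hnn : (((v / s).toNNReal : ℝ) : ℂ) = v / s := by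
    rw [Real.coe_toNNReal _ hvs]; push_cast; rfl
  rw [show (((v / s).toNNReal : NNReal) : ℂ) = (((v / s).toNNReal : ℝ) : ℂ) from rfl, hnn]
  push_cast
  field_simp
  ring

lemma hasGaussianLaw_of_map_inner [IsProbabilityMeasure P] {m : E n → ℝ} {v : E n → NNReal}
    (hX : Measurable X)
    (h : ∀ t, P.map (fun ω => ⟪t, X ω⟫) = gaussianReal (m t) (v t)) : HasGaussianLaw X P := by
  rw [hasGaussianLaw_iff_charFun_map_eq hX.aemeasurable]
  intro t
  have hl : HasLaw (fun ω => ⟪t, X ω⟫) (gaussianReal (m t) (v t)) P :=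
    ⟨(by fun_prop : Measurable _).aemeasurable, h t⟩
  have h1 := charFun_gaussianReal (μ := m t) (v := v t) 1
  rw [← h t, charFun_apply_real, integral_map (by fun_prop) (by fun_prop)] at h1
  rw [hl.integral_eq, hl.variance_eq, integral_id_gaussianReal, variance_id_gaussianReal,
    charFun_apply, integral_map hX.aemeasurable (by fun_prop)]
  simp_rw [real_inner_comm]
  simpa using h1

/-- If two independent channel inputs have affine posterior means with the same linear part, they
are Gaussian with the same covariance. -/
lemma gaussian_of_condMean_affine [IsProbabilityMeasure P] (hγ : 0 < γ) {X₁ X₂ Z₁ Z₂ : Ω → E n}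
    (hX₁ : Measurable X₁) (hX₂ : Measurable X₂) (hZ₁ : Measurable Z₁) (hZ₂ : Measurable Z₂)
    (hX₁_L2 : MemLp X₁ 2 P) (hX₂_L2 : MemLp X₂ 2 P)
    (h₁ : IndepFun X₁ Z₁ P) (h₂ : IndepFun X₂ Z₂ P)
    (hZ₁l : HasLaw Z₁ (stdGaussian (E n)) P) (hZ₂l : HasLaw Z₂ (stdGaussian (E n)) P)
    {A : E n →L[ℝ] E n} {c₁ c₂ : E n}
    (hc₁ : condMean P X₁ (chan γ X₁ Z₁) =ᵐ[P] fun ω => A (chan γ X₁ Z₁ ω) + c₁)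
    (hc₂ : condMean P X₂ (chan γ X₂ Z₂) =ᵐ[P] fun ω => A (chan γ X₂ Z₂ ω) + c₂) :
    HasGaussianLaw X₁ P ∧ HasGaussianLaw X₂ P ∧ covMatrix X₁ P = covMatrix X₂ P := by
  have hi₁ := hX₁_L2.integrable one_le_two
  have hi₂ := hX₂_L2.integrable one_le_two
  -- The equation for `w` involves only `A` and `t`, so one choice serves both inputs and yields
  -- equal variances.
  choose w hw using exists_sub_smul_adjoint_eq hX₁ hZ₁ hi₁ h₁ hZ₁l hc₁
  have l₁ := fun t => (map_inner_of_condMean_affine hγ hX₁ hZ₁ hi₁ h₁ hZ₁l hc₁ (hw t)).2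
  have l₂ := fun t => (map_inner_of_condMean_affine hγ hX₂ hZ₂ hi₂ h₂ hZ₂l hc₂ (hw t)).2
  refine ⟨hasGaussianLaw_of_map_inner hX₁ l₁, hasGaussianLaw_of_map_inner hX₂ l₂, ?_⟩
  have hvar : ∀ t, Var[fun ω => ⟪t, X₁ ω⟫; P] = Var[fun ω => ⟪t, X₂ ω⟫; P] := fun t => by
    rw [(HasLaw.mk (by fun_prop) (l₁ t)).variance_eq, (HasLaw.mk (by fun_prop) (l₂ t)).variance_eq,
      variance_id_gaussianReal, variance_id_gaussianReal]
  -- Polarisation recovers the covariance entries from variances of projections.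
  have hcov : ∀ {V : Ω → E n}, MemLp V 2 P → ∀ i j, 2 * cov[fun ω => V ω i, fun ω => V ω j; P]
      = Var[fun ω => ⟪EuclideanSpace.single i (1 : ℝ) + EuclideanSpace.single j 1, V ω⟫; P]
        - Var[fun ω => ⟪EuclideanSpace.single i (1 : ℝ), V ω⟫; P]
        - Var[fun ω => ⟪EuclideanSpace.single j (1 : ℝ), V ω⟫; P] := by
    intro V hV i j
    have hVi : ∀ i, MemLp (fun ω => V ω i) 2 P := fun i =>
      (EuclideanSpace.proj (𝕜 := ℝ) i).comp_memLp' hV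
    simp only [inner_add_left, EuclideanSpace.inner_single_left, map_one, one_mul]
    rw [variance_fun_add (hVi i) (hVi j)]
    ring
  ext i j
  have e1 := hcov hX₁_L2 i j
  have e2 := hcov hX₂_L2 i j
  simp only [hvar] at e1
  rw [covMatrix, covMatrix, Matrix.of_apply, Matrix.of_apply]
  linarith

end affine

/-! ### The converse: Gaussian inputs with equal covariance -/

section gaussian

variable {P : Measure Ω}

/-- Rotating two independent Gaussian vectors with the same covariance keeps them independent. -/
lemma indepFun_rotate_of_gaussian [IsProbabilityMeasure P] {ι : Type*} [Fintype ι] {U V : Ω → ι → ℝ}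
    (hU : HasGaussianLaw U P) (hV : HasGaussianLaw V P) (hUV : IndepFun U V P)
    (hcov : ∀ i j, cov[fun ω => U ω i, fun ω => U ω j; P] = cov[fun ω => V ω i, fun ω => V ω j; P])
    (a b : ℝ) :
    IndepFun (fun ω i => a * U ω i + b * V ω i) (fun ω i => b * U ω i - a * V ω i) P := by
  have hL := (hUV.hasGaussianLaw hU hV).map_fun
    ((a • ContinuousLinearMap.fst ℝ (ι → ℝ) (ι → ℝ) + b • ContinuousLinearMap.snd ℝ _ _).prod
      (b • ContinuousLinearMap.fst ℝ (ι → ℝ) (ι → ℝ) - a • ContinuousLinearMap.snd ℝ _ _))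
  -- Jointly Gaussian vectors are independent once uncorrelated; here the cross-covariance is `a b
  -- (K_U - K_V)`, which is 0.
  refine HasGaussianLaw.indepFun_of_covariance_eval
    (X := fun i ω => a * U ω i + b * V ω i) (Y := fun i ω => b * U ω i - a * V ω i) hL
    fun i j => ?_
  have hUi : ∀ i, MemLp (fun ω => U ω i) 2 P := fun i => (hU.eval i).memLp_two
  have hVi : ∀ i, MemLp (fun ω => V ω i) 2 P := fun i => (hV.eval i).memLp_two
  have hind : ∀ i j, IndepFun (fun ω => U ω i) (fun ω => V ω j) P := fun i j =>
    hUV.comp (measurable_pi_apply i) (measurable_pi_apply j)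
  have hW : MemLp (fun ω => b * U ω j - a * V ω j) 2 P :=
    ((hUi j).const_mul b).sub ((hVi j).const_mul a)
  rw [show (fun ω => a * U ω i + b * V ω i) = (fun ω => a * U ω i) + fun ω => b * V ω i from rfl,
    covariance_add_left ((hUi i).const_mul a) ((hVi i).const_mul b) hW,
    covariance_fun_sub_right ((hUi i).const_mul a) ((hUi j).const_mul b) ((hVi j).const_mul a),
    covariance_fun_sub_right ((hVi i).const_mul b) ((hUi j).const_mul b) ((hVi j).const_mul a)]
  simp only [covariance_const_mul_left, covariance_const_mul_right]
  rw [(hind i j).covariance_eq_zero (hUi i) (hVi j),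
    (hind j i).symm.covariance_eq_zero (hVi i) (hUi j), hcov i j]
  ring

lemma condMean_eq_of_comp {F G : Type*} [MeasurableSpace F] [MeasurableSpace G] (X : Ω → E n)
    {Y : Ω → F} {W : Ω → G} {f : F → G} {g : G → F} (hf : Measurable f) (hg : Measurable g)
    (h1 : W = f ∘ Y) (h2 : Y = g ∘ W) : condMean P X Y = condMean P X W := by
  have : MeasurableSpace.comap Y inferInstance = MeasurableSpace.comap W inferInstance := by
    refine le_antisymm ?_ ?_
    · conv_lhs => rw [h2]
      exact (hg.comp (comap_measurable W)).comap_le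
    · conv_lhs => rw [h1]
      exact (hf.comp (comap_measurable Y)).comap_le
  rw [condMean, condMean, this]

lemma measurable_mix (α : ℝ) {U V : Ω → E n} (hU : Measurable U) (hV : Measurable V) :
    Measurable (mix α U V) := by
  unfold mix; fun_prop

/-- Lets every result on a single channel apply to the mixed output. -/
lemma mix_chan (α γ : ℝ) (X₁ X₂ Z₁ Z₂ : Ω → E n) :
    mix α (chan γ X₁ Z₁) (chan γ X₂ Z₂) = chan γ (mix α X₁ X₂) (mix α Z₁ Z₂) := by
  funext ω
  simp only [mix, chan, smul_add, smul_smul]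
  rw [mul_comm (√γ), mul_comm (√γ)]
  abel

/-- For Gaussian inputs with the same covariance, the mixed output is sufficient. -/
lemma condMean_mix_of_gaussian [IsProbabilityMeasure P] {X₁ X₂ Z₁ Z₂ : Ω → E n} {α γ : ℝ}
    (hα0 : 0 ≤ α) (hα1 : α ≤ 1)
    (hX₁ : Measurable X₁) (hX₂ : Measurable X₂) (hZ₁ : Measurable Z₁) (hZ₂ : Measurable Z₂)
    (h₁ : IndepFun X₁ Z₁ P) (h₂ : IndepFun X₂ Z₂ P)
    (h₁₂ : IndepFun (fun ω => (X₁ ω, Z₁ ω)) (fun ω => (X₂ ω, Z₂ ω)) P)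
    (hZ₁l : HasLaw Z₁ (stdGaussian (E n)) P) (hZ₂l : HasLaw Z₂ (stdGaussian (E n)) P)
    (hG₁ : HasGaussianLaw X₁ P) (hG₂ : HasGaussianLaw X₂ P)
    (hcov : covMatrix X₁ P = covMatrix X₂ P) :
    condMean P (mix α X₁ X₂) (mix α (chan γ X₁ Z₁) (chan γ X₂ Z₂))
      =ᵐ[P] condMean P (mix α X₁ X₂) (fun ω => (chan γ X₁ Z₁ ω, chan γ X₂ Z₂ ω)) := by
  set a := √(1 - α) with ha
  set b := √α with hb
  have hab : a * a + b * b = 1 := by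
    rw [ha, hb, Real.mul_self_sqrt (by linarith), Real.mul_self_sqrt hα0]; ring
  have hgz₁ : HasGaussianLaw Z₁ P := hZ₁l.hasGaussianLaw
  have hgz₂ : HasGaussianLaw Z₂ P := hZ₂l.hasGaussianLaw
  -- Stacks input and noise into one vector of `2n` coordinates, so that a single rotation handles
  -- both.
  let L : E n × E n →L[ℝ] (Fin n ⊕ Fin n → ℝ) := ContinuousLinearMap.pi fun k =>
    Sum.elim (fun i => (EuclideanSpace.proj (𝕜 := ℝ) i).comp (ContinuousLinearMap.fst ℝ (E n) (E
      n)))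
      (fun i => (EuclideanSpace.proj (𝕜 := ℝ) i).comp (ContinuousLinearMap.snd ℝ (E n) (E n))) k
  have hproj : ∀ {V : Ω → E n}, HasGaussianLaw V P → ∀ i, MemLp (fun ω => V ω i) 2 P :=
    fun hV i => (EuclideanSpace.proj (𝕜 := ℝ) i).comp_memLp' hV.memLp_two
  have hzero : ∀ {V W : Ω → E n}, HasGaussianLaw V P → HasGaussianLaw W P → IndepFun V W P →
      ∀ i j, cov[fun ω => V ω i, fun ω => W ω j; P] = 0 := fun {V W} hV hW hVW i j =>
    IndepFun.covariance_eq_zero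
      (hVW.comp (φ := fun x : E n => x i) (ψ := fun x : E n => x j) (by fun_prop) (by fun_prop))
      (hproj hV i) (hproj hW j)
  have hind := indepFun_rotate_of_gaussian (U := fun ω => L (X₁ ω, Z₁ ω))
    (V := fun ω => L (X₂ ω, Z₂ ω)) ((h₁.hasGaussianLaw hG₁ hgz₁).map_fun L)
    ((h₂.hasGaussianLaw hG₂ hgz₂).map_fun L)
    (h₁₂.comp L.continuous.measurable L.continuous.measurable) ?_ a b
  · set Y := mix α (chan γ X₁ Z₁) (chan γ X₂ Z₂) with hY
    -- Since `a² + b² = 1`, the map from `(Y₁, Y₂)` to `(Y, W)` is an orthogonal involution, so both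
    -- pairs generate the same σ-algebra.
    set W : Ω → E n := fun ω => b • chan γ X₁ Z₁ ω - a • chan γ X₂ Z₂ ω with hW
    have hY₁m := measurable_chan γ hX₁ hZ₁
    have hY₂m := measurable_chan γ hX₂ hZ₂
    have hXm : Measurable (mix α X₁ X₂) := measurable_mix α hX₁ hX₂
    have hYm : Measurable Y := measurable_mix α hY₁m hY₂m
    have hWm : Measurable W := by fun_prop
    have hXi : Integrable (mix α X₁ X₂) P := (hG₁.integrable.smul a).add (hG₂.integrable.smul b)
    have hXYW : IndepFun (fun ω => (mix α X₁ X₂ ω, Y ω)) W P := by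
      let φ : (Fin n ⊕ Fin n → ℝ) → E n × E n := fun u =>
        (WithLp.toLp 2 fun i => u (Sum.inl i),
          WithLp.toLp 2 fun i => √γ * u (Sum.inl i) + u (Sum.inr i))
      let ψ : (Fin n ⊕ Fin n → ℝ) → E n := fun u =>
        WithLp.toLp 2 fun i => √γ * u (Sum.inl i) + u (Sum.inr i)
      have hφ : Measurable φ := by fun_prop
      have hψ : Measurable ψ := by fun_prop
      convert hind.comp hφ hψ using 1
      · funext ω
        refine Prod.ext ?_ ?_
        · ext i
          simp [φ, L, mix, ha, hb]
        · ext i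
          simp [φ, L, mix, chan, hY, ha, hb]
          ring
      · funext ω
        ext i
        simp [ψ, L, chan, hW]
        ring
    have hcm := condMean_prodMk_of_indepFun hXm hYm hWm hXi hXYW
    refine hcm.symm.trans (Filter.EventuallyEq.of_eq ?_)
    refine condMean_eq_of_comp _ (f := fun q : E n × E n => (a • q.1 + b • q.2, b • q.1 - a • q.2))
      (g := fun q : E n × E n => (a • q.1 + b • q.2, b • q.1 - a • q.2)) (by fun_prop)
      (by fun_prop) ?_ rfl
    funext ω
    refine Prod.ext ?_ ?_
    · change chan γ X₁ Z₁ ω = a • (a • chan γ X₁ Z₁ ω + b • chan γ X₂ Z₂ ω)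
        + b • (b • chan γ X₁ Z₁ ω - a • chan γ X₂ Z₂ ω)
      calc chan γ X₁ Z₁ ω = (a * a + b * b) • chan γ X₁ Z₁ ω := by rw [hab, one_smul]
        _ = _ := by module
    · change chan γ X₂ Z₂ ω = b • (a • chan γ X₁ Z₁ ω + b • chan γ X₂ Z₂ ω)
        - a • (b • chan γ X₁ Z₁ ω - a • chan γ X₂ Z₂ ω)
      calc chan γ X₂ Z₂ ω = (a * a + b * b) • chan γ X₂ Z₂ ω := by rw [hab, one_smul]
        _ = _ := by module
  -- Covariance of the stacked vectors by blocks: the input blocks agree by hypothesis, the mixed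
  -- blocks vanish, and the noise blocks come from the same law.
  · rintro (i | i) (j | j)
    · exact congrFun (congrFun hcov i) j
    · exact (hzero hG₁ hgz₁ h₁ i j).trans (hzero hG₂ hgz₂ h₂ i j).symm
    · exact (hzero hgz₁ hG₁ h₁.symm i j).trans (hzero hgz₂ hG₂ h₂.symm i j).symm
    · have e1 := hZ₁l.covariance_comp (f := fun z : E n => z i) (g := fun z : E n => z j)
        (by fun_prop) (by fun_prop)
      have e2 := hZ₂l.covariance_comp (f := fun z : E n => z i) (g := fun z : E n => z j)
        (by fun_prop) (by fun_prop)
      exact e1.trans e2.symm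

end gaussian

/-! ### Orthogonality in `L²` -/

section L2

variable {P : Measure Ω}

lemma lintegral_enorm_sq_eq [IsProbabilityMeasure P] {V : Ω → E n} (hV : MemLp V 2 P) :
    ∫⁻ ω, ‖V ω‖ₑ ^ 2 ∂P = ENNReal.ofReal (∫ ω, ‖V ω‖ ^ 2 ∂P) := by
  rw [ofReal_integral_eq_lintegral_ofReal hV.integrable_norm_pow'
    (ae_of_all _ fun ω => by positivity)]
  refine lintegral_congr fun ω => ?_
  rw [ENNReal.ofReal_pow (norm_nonneg _), ofReal_norm]

lemma lintegral_enorm_sub_sq_eq_zero_iff {U V : Ω → E n} (hU : Integrable U P)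
    (hV : Integrable V P) : ∫⁻ ω, ‖U ω - V ω‖ₑ ^ 2 ∂P = 0 ↔ U =ᵐ[P] V := by
  have hm : AEMeasurable (fun ω => ‖U ω - V ω‖ₑ ^ 2) P :=
    (hU.sub hV).aestronglyMeasurable.enorm.pow_const 2
  rw [lintegral_eq_zero_iff' hm]
  refine Filter.eventually_congr (ae_of_all _ fun ω => ?_)
  simp [sub_eq_zero]

lemma integrable_inner_of_memLp {U V : Ω → E n} (hU : MemLp U 2 P) (hV : MemLp V 2 P) :
    Integrable (fun ω => ⟪U ω, V ω⟫) P := by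
  refine (MemLp.integrable_mul hU.norm hV.norm).mono'
    (hU.aestronglyMeasurable.inner hV.aestronglyMeasurable) (ae_of_all _ fun ω => ?_)
  exact norm_inner_le_norm _ _

/-- A vector in `L²` equals its conditional expectation iff their second moments agree. -/
lemma ae_eq_condMean_iff_lintegral_enorm_sq_eq [IsProbabilityMeasure P] {F : Type*}
    [MeasurableSpace F] {S R : Ω → E n}
    {Y : Ω → F} (hY : Measurable Y) (hS : MemLp S 2 P) (hR : R =ᵐ[P] condMean P S Y) :
    R =ᵐ[P] S ↔ ∫⁻ ω, ‖S ω‖ₑ ^ 2 ∂P = ∫⁻ ω, ‖R ω‖ₑ ^ 2 ∂P := by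
  have hC : MemLp (condMean P S Y) 2 P := hS.condExp one_le_two
  have hRL : MemLp R 2 P := hC.ae_eq hR.symm
  have hm : MeasurableSpace.comap Y inferInstance ≤ mΩ := hY.comap_le
  -- `R` is a version of the orthogonal projection of `S`, whence the Pythagorean identity below.
  have horth : ∫ ω, ⟪R ω, S ω⟫ ∂P = ∫ ω, ‖R ω‖ ^ 2 ∂P := by
    have hpull := condExp_bilin_of_stronglyMeasurable_left (μ := P) (innerSL ℝ)
      (f := condMean P S Y) (g := S) (m := MeasurableSpace.comap Y inferInstance)
      stronglyMeasurable_condExp (integrable_inner_of_memLp hC hS) (hS.integrable one_le_two)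
    calc ∫ ω, ⟪R ω, S ω⟫ ∂P = ∫ ω, ⟪condMean P S Y ω, S ω⟫ ∂P := by
          refine integral_congr_ae ?_
          filter_upwards [hR] with ω hω
          rw [hω]
      _ = ∫ ω, ⟪condMean P S Y ω, condMean P S Y ω⟫ ∂P := by
          rw [← integral_condExp hm (f := fun ω => ⟪condMean P S Y ω, S ω⟫)]
          exact integral_congr_ae hpull
      _ = _ := by
          refine integral_congr_ae ?_
          filter_upwards [hR] with ω hω
          rw [hω, real_inner_self_eq_norm_sq]
  have hpyth : ∫ ω, ‖R ω - S ω‖ ^ 2 ∂P = ∫ ω, ‖S ω‖ ^ 2 ∂P - ∫ ω, ‖R ω‖ ^ 2 ∂P := by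
    have hiR : Integrable (fun ω => ‖R ω‖ ^ 2) P := hRL.integrable_norm_pow'
    have hiS : Integrable (fun ω => ‖S ω‖ ^ 2) P := hS.integrable_norm_pow'
    have hiI := (integrable_inner_of_memLp hRL hS).const_mul 2
    simp_rw [norm_sub_sq_real]
    have hiRI : Integrable (fun ω => ‖R ω‖ ^ 2 - 2 * ⟪R ω, S ω⟫) P := hiR.sub hiI
    rw [integral_add hiRI hiS, integral_sub hiR hiI, integral_const_mul, horth]
    ring
  have hdiff : Integrable (fun ω => ‖R ω - S ω‖ ^ 2) P := (hRL.sub hS).integrable_norm_pow'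
  have hzero : R =ᵐ[P] S ↔ ∫ ω, ‖R ω - S ω‖ ^ 2 ∂P = 0 := by
    rw [integral_eq_zero_iff_of_nonneg (fun ω => by positivity) hdiff]
    refine Filter.eventually_congr (ae_of_all _ fun ω => ?_)
    simp [sub_eq_zero]
  rw [hzero, hpyth, sub_eq_zero, lintegral_enorm_sq_eq hS, lintegral_enorm_sq_eq hRL,
    ENNReal.ofReal_eq_ofReal_iff (integral_nonneg fun ω => by positivity)
      (integral_nonneg fun ω => by positivity)]

lemma integrable_mix (α : ℝ) {U V : Ω → E n} (hU : Integrable U P) (hV : Integrable V P) :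
    Integrable (mix α U V) P :=
  Integrable.add (f := fun ω => √(1 - α) • U ω) (g := fun ω => √α • V ω) (hU.smul √(1 - α))
    (hV.smul √α)

lemma memLp_mix (α : ℝ) {U V : Ω → E n} (hU : MemLp U 2 P) (hV : MemLp V 2 P) :
    MemLp (mix α U V) 2 P :=
  MemLp.add (f := fun ω => √(1 - α) • U ω) (g := fun ω => √α • V ω) (hU.const_smul √(1 - α))
    (hV.const_smul √α)

/-- By independence the cross term is the inner product of the means, so centring one of the two
vectors is enough. -/
lemma lintegral_enorm_sq_mix [IsProbabilityMeasure P] {U V : Ω → E n} (hU : MemLp U 2 P)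
    (hV : MemLp V 2 P)
    (hUV : IndepFun U V P) (h0 : ∫ ω, U ω ∂P = 0) {α : ℝ} (hα0 : 0 ≤ α) (hα1 : α ≤ 1) :
    ENNReal.ofReal (1 - α) * ∫⁻ ω, ‖U ω‖ₑ ^ 2 ∂P + ENNReal.ofReal α * ∫⁻ ω, ‖V ω‖ₑ ^ 2 ∂P
      = ∫⁻ ω, ‖mix α U V ω‖ₑ ^ 2 ∂P := by
  have hM : MemLp (mix α U V) 2 P := memLp_mix α hU hV
  have hinner : ∫ ω, ⟪U ω, V ω⟫ ∂P = 0 := by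
    have := hUV.integral_bilin (hU.integrable one_le_two) (hV.integrable one_le_two) (innerSL ℝ)
    rw [h0, map_zero, _root_.zero_apply] at this
    exact this
  have hα1' : 0 ≤ 1 - α := by linarith
  have e : ∫ ω, ‖mix α U V ω‖ ^ 2 ∂P
      = (1 - α) * ∫ ω, ‖U ω‖ ^ 2 ∂P + α * ∫ ω, ‖V ω‖ ^ 2 ∂P := by
    have hpt : ∀ ω, ‖mix α U V ω‖ ^ 2
        = (1 - α) * ‖U ω‖ ^ 2 + 2 * (√(1 - α) * √α) * ⟪U ω, V ω⟫ + α * ‖V ω‖ ^ 2 := fun ω => by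
      rw [mix, norm_add_sq_real, norm_smul, norm_smul, mul_pow, mul_pow, norm_of_nonneg
        (sqrt_nonneg _), norm_of_nonneg (sqrt_nonneg _), sq_sqrt hα1', sq_sqrt hα0,
        real_inner_smul_left, real_inner_smul_right]
      ring
    have i1 : Integrable (fun ω => (1 - α) * ‖U ω‖ ^ 2) P := hU.integrable_norm_pow'.const_mul _
    have i2 : Integrable (fun ω => 2 * (√(1 - α) * √α) * ⟪U ω, V ω⟫) P :=
      (integrable_inner_of_memLp hU hV).const_mul _
    have i3 : Integrable (fun ω => α * ‖V ω‖ ^ 2) P := hV.integrable_norm_pow'.const_mul _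
    simp_rw [hpt]
    have i12 : Integrable
      (fun ω => (1 - α) * ‖U ω‖ ^ 2 + 2 * (√(1 - α) * √α) * ⟪U ω, V ω⟫) P := i1.add i2
    rw [integral_add i12 i3, integral_add i1 i2, integral_const_mul, integral_const_mul,
      integral_const_mul, hinner]
    ring
  rw [lintegral_enorm_sq_eq hU, lintegral_enorm_sq_eq hV, lintegral_enorm_sq_eq hM, e,
    ENNReal.ofReal_add (mul_nonneg hα1' (integral_nonneg fun ω => by positivity))
      (mul_nonneg hα0 (integral_nonneg fun ω => by positivity)),
    ENNReal.ofReal_mul hα1', ENNReal.ofReal_mul hα0]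

lemma condMean_mix {F : Type*} [MeasurableSpace F] {U V : Ω → E n} {W : Ω → F} (α : ℝ)
    (hU : Integrable U P) (hV : Integrable V P) :
    condMean P (mix α U V) W =ᵐ[P] mix α (condMean P U W) (condMean P V W) := by
  have h1 := condExp_add (hU.smul √(1 - α)) (hV.smul √α) (MeasurableSpace.comap W inferInstance)
  have h2 := condExp_smul (μ := P) √(1 - α) U (MeasurableSpace.comap W inferInstance)
  have h3 := condExp_smul (μ := P) √α V (MeasurableSpace.comap W inferInstance)
  exact h1.trans (h2.add h3)

lemma hasLaw_mix_stdGaussian [IsProbabilityMeasure P] {Z₁ Z₂ : Ω → E n} {α : ℝ} (hα0 : 0 ≤ α)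
    (hα1 : α ≤ 1)
    (hZ₁ : Measurable Z₁) (hZ₂ : Measurable Z₂) (h : IndepFun Z₁ Z₂ P)
    (hZ₁l : HasLaw Z₁ (stdGaussian (E n)) P) (hZ₂l : HasLaw Z₂ (stdGaussian (E n)) P) :
    HasLaw (mix α Z₁ Z₂) (stdGaussian (E n)) P := by
  refine ⟨(measurable_mix α hZ₁ hZ₂).aemeasurable, ?_⟩
  have hp : IsProbabilityMeasure (P.map (mix α Z₁ Z₂)) :=
    P.isProbabilityMeasure_map (measurable_mix α hZ₁ hZ₂).aemeasurable
  refine Measure.ext_of_charFun ?_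
  have hi : IndepFun (fun ω => √(1 - α) • Z₁ ω) (fun ω => √α • Z₂ ω) P :=
    h.comp (measurable_const_smul √(1 - α)) (measurable_const_smul √α)
  have h1 := hi.charFun_map_add_eq_mul (by fun_prop) (by fun_prop)
  ext t
  refine (congrFun h1 t).trans ?_
  rw [Pi.mul_apply, charFun_stdGaussian,
    show (fun ω => √(1 - α) • Z₁ ω) = (fun z => √(1 - α) • z) ∘ Z₁ from rfl,
    show (fun ω => √α • Z₂ ω) = (fun z => √α • z) ∘ Z₂ from rfl,
    ← Measure.map_map (measurable_const_smul _) hZ₁, ← Measure.map_map (measurable_const_smul _)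
      hZ₂,
    charFun_map_smul, charFun_map_smul, hZ₁l.map_eq, hZ₂l.map_eq, charFun_stdGaussian,
    charFun_stdGaussian, ← Complex.exp_add, norm_smul, norm_smul, norm_of_nonneg
        (sqrt_nonneg _), norm_of_nonneg (sqrt_nonneg _)]
  congr 1
  have e1 : ((√(1 - α) : ℝ) : ℂ) ^ 2 = 1 - α := by
    rw [← Complex.ofReal_pow, sq_sqrt (by linarith)]; push_cast; rfl
  have e2 : ((√α : ℝ) : ℂ) ^ 2 = α := by
    rw [← Complex.ofReal_pow, sq_sqrt hα0]
  push_cast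
  rw [mul_pow, mul_pow, e1, e2]
  ring

end L2

/-- Continuous solutions of Pexider's equation are affine with the same linear part. -/
lemma exists_affine_of_pexider {g g₁ g₂ : E n → E n} (hg : Continuous g) {a b : ℝ}
    (ha : a ≠ 0) (hb : b ≠ 0) (h : ∀ x y, g (a • x + b • y) = a • g₁ x + b • g₂ y) :
    ∃ A : E n →L[ℝ] E n, (∀ x, g₁ x = A x + g₁ 0) ∧ ∀ y, g₂ y = A y + g₂ 0 := by
  have h1 : ∀ x, g (a • x) = a • g₁ x + b • g₂ 0 := fun x => by simpa using h x 0
  have h2 : ∀ y, g (b • y) = a • g₁ 0 + b • g₂ y := fun y => by simpa using h 0 y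
  have h0 : g 0 = a • g₁ 0 + b • g₂ 0 := by simpa using h 0 0
  -- The specialisations at 0 reduce the equation to Cauchy's equation for `g - g 0`; continuity
  -- then makes the additive map real-linear.
  have hadd : ∀ u v, g (u + v) - g 0 = (g u - g 0) + (g v - g 0) := by
    intro u v
    have e := h (a⁻¹ • u) (b⁻¹ • v)
    have e1 := h1 (a⁻¹ • u)
    have e2 := h2 (b⁻¹ • v)
    rw [smul_inv_smul₀ ha] at e e1
    rw [smul_inv_smul₀ hb] at e e2
    rw [e, e1, e2, h0]
    abel
  let A₀ : E n →+ E n := AddMonoidHom.mk' (fun u => g u - g 0) hadd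
  let A : E n →L[ℝ] E n := A₀.toRealLinearMap (hg.sub continuous_const)
  have hA : ∀ u, A u = g u - g 0 := fun _ => rfl
  refine ⟨A, fun x => ?_, fun y => ?_⟩
  · have e : a • A x = a • (g₁ x - g₁ 0) := by
      rw [← map_smul, hA, h1, h0, smul_sub]; abel
    rw [(smul_right_injective _ ha) e]; abel
  · have e : b • A y = b • (g₂ y - g₂ 0) := by
      rw [← map_smul, hA, h2, h0, smul_sub]; abel
    rw [(smul_right_injective _ hb) e]; abel

/-- Two square-integrable inputs and two standard Gaussian noises, independent of each other. -/
structure IsChannelPair (P : Measure Ω) (X₁ X₂ Z₁ Z₂ : Ω → E n) : Prop where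
  measX₁ : Measurable X₁
  measX₂ : Measurable X₂
  measZ₁ : Measurable Z₁
  measZ₂ : Measurable Z₂
  memLpX₁ : MemLp X₁ 2 P
  memLpX₂ : MemLp X₂ 2 P
  indep₁ : IndepFun X₁ Z₁ P
  indep₂ : IndepFun X₂ Z₂ P
  indepZ : IndepFun Z₁ Z₂ P
  indepPairs : IndepFun (fun ω => (X₁ ω, Z₁ ω)) (fun ω => (X₂ ω, Z₂ ω)) P
  indepNoise : IndepFun (fun ω => (X₁ ω, X₂ ω)) (fun ω => (Z₁ ω, Z₂ ω)) P
  lawZ₁ : HasLaw Z₁ (stdGaussian (E n)) P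
  lawZ₂ : HasLaw Z₂ (stdGaussian (E n)) P

/-! ### Sufficiency, deficit, scores and Fisher information for two channels -/

namespace IsChannelPair

variable {P : Measure Ω} {X₁ X₂ Z₁ Z₂ : Ω → E n} {α γ : ℝ}

lemma indepFun_mix (h : IsChannelPair P X₁ X₂ Z₁ Z₂) (α : ℝ) :
    IndepFun (mix α X₁ X₂) (mix α Z₁ Z₂) P :=
  h.indepNoise.comp (φ := fun q : E n × E n => √(1 - α) • q.1 + √α • q.2)
    (ψ := fun q : E n × E n => √(1 - α) • q.1 + √α • q.2) (by fun_prop) (by fun_prop)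

lemma indepFun_chan (h : IsChannelPair P X₁ X₂ Z₁ Z₂) (γ : ℝ) :
    IndepFun (chan γ X₁ Z₁) (chan γ X₂ Z₂) P :=
  h.indepPairs.comp (φ := fun q : E n × E n => √γ • q.1 + q.2)
    (ψ := fun q : E n × E n => √γ • q.1 + q.2) (by fun_prop) (by fun_prop)

/-- By linearity each input can be treated alone, and the other channel's output is independent of
that input and its own output. -/
lemma condMean_pair [IsProbabilityMeasure P] (h : IsChannelPair P X₁ X₂ Z₁ Z₂) (α γ : ℝ) :
    condMean P (mix α X₁ X₂) (fun ω => (chan γ X₁ Z₁ ω, chan γ X₂ Z₂ ω))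
      =ᵐ[P] mix α (condMean P X₁ (chan γ X₁ Z₁)) (condMean P X₂ (chan γ X₂ Z₂)) := by
  have i₁ := h.memLpX₁.integrable one_le_two
  have i₂ := h.memLpX₂.integrable one_le_two
  have m₁ := measurable_chan γ h.measX₁ h.measZ₁
  have m₂ := measurable_chan γ h.measX₂ h.measZ₂
  have c₁ := condMean_prodMk_of_indepFun h.measX₁ m₁ m₂ i₁
    (h.indepPairs.comp (φ := fun q : E n × E n => (q.1, √γ • q.1 + q.2))
      (ψ := fun q : E n × E n => √γ • q.1 + q.2) (by fun_prop) (by fun_prop))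
  have c₂ := condMean_prodMk_of_indepFun h.measX₂ m₂ m₁ i₂
    (h.indepPairs.symm.comp (φ := fun q : E n × E n => (q.1, √γ • q.1 + q.2))
      (ψ := fun q : E n × E n => √γ • q.1 + q.2) (by fun_prop) (by fun_prop))
  rw [condMean_eq_of_comp (P := P) X₂ (Y := fun ω => (chan γ X₂ Z₂ ω, chan γ X₁ Z₁ ω))
    (W := fun ω => (chan γ X₁ Z₁ ω, chan γ X₂ Z₂ ω))
    measurable_swap measurable_swap rfl rfl] at c₂
  refine (condMean_mix α i₁ i₂).trans ?_
  filter_upwards [c₁, c₂] with ω h1 h2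
  rw [mix, mix, h1, h2]

lemma condMean_mix_chan [IsProbabilityMeasure P] (h : IsChannelPair P X₁ X₂ Z₁ Z₂) (hα0 : 0 ≤ α)
    (hα1 : α ≤ 1) (γ : ℝ) :
    condMean P (mix α X₁ X₂) (mix α (chan γ X₁ Z₁) (chan γ X₂ Z₂))
      =ᵐ[P] fun ω => postMean (P.map (mix α X₁ X₂)) √γ
        (mix α (chan γ X₁ Z₁) (chan γ X₂ Z₂) ω) := by
  have i₁ := h.memLpX₁.integrable one_le_two
  have i₂ := h.memLpX₂.integrable one_le_two
  rw [mix_chan]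
  exact condMean_chan (measurable_mix α h.measX₁ h.measX₂) (measurable_mix α h.measZ₁ h.measZ₂)
    (integrable_mix α i₁ i₂) (h.indepFun_mix α)
    (hasLaw_mix_stdGaussian hα0 hα1 h.measZ₁ h.measZ₂ h.indepZ h.lawZ₁ h.lawZ₂)

/-- The mixed output is sufficient for the mixed input iff the inputs are Gaussian with the same
covariance. -/
lemma condMean_eq_iff_gaussian [IsProbabilityMeasure P] (h : IsChannelPair P X₁ X₂ Z₁ Z₂)
    (hα0 : 0 < α) (hα1 : α < 1)
    (hγ : 0 < γ) :
    condMean P (mix α X₁ X₂) (mix α (chan γ X₁ Z₁) (chan γ X₂ Z₂))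
      =ᵐ[P] condMean P (mix α X₁ X₂) (fun ω => (chan γ X₁ Z₁ ω, chan γ X₂ Z₂ ω)) ↔
    HasGaussianLaw X₁ P ∧ HasGaussianLaw X₂ P ∧ covMatrix X₁ P = covMatrix X₂ P := by
  refine ⟨fun heq => ?_, fun ⟨g₁, g₂, hc⟩ => condMean_mix_of_gaussian hα0.le hα1.le h.measX₁
    h.measX₂ h.measZ₁ h.measZ₂ h.indep₁ h.indep₂ h.indepPairs h.lawZ₁ h.lawZ₂ g₁ g₂ hc⟩
  have i₁ := h.memLpX₁.integrable one_le_two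
  have i₂ := h.memLpX₂.integrable one_le_two
  have mX := measurable_mix α h.measX₁ h.measX₂
  have m₁ := measurable_chan γ h.measX₁ h.measZ₁
  have m₂ := measurable_chan γ h.measX₂ h.measZ₂
  have iX : Integrable (mix α X₁ X₂) P := integrable_mix α i₁ i₂
  have p : IsProbabilityMeasure (P.map (mix α X₁ X₂)) := P.isProbabilityMeasure_map mX.aemeasurable
  have p₁ : IsProbabilityMeasure (P.map X₁) := P.isProbabilityMeasure_map h.measX₁.aemeasurable
  have p₂ : IsProbabilityMeasure (P.map X₂) := P.isProbabilityMeasure_map h.measX₂.aemeasurable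
  have gc := continuous_postMean (s := √γ) (integrable_id_map mX iX)
  have gc₁ := continuous_postMean (s := √γ) (integrable_id_map h.measX₁ i₁)
  have gc₂ := continuous_postMean (s := √γ) (integrable_id_map h.measX₂ i₂)
  have e₁ := condMean_chan (γ := γ) h.measX₁ h.measZ₁ i₁ h.indep₁ h.lawZ₁
  have e₂ := condMean_chan (γ := γ) h.measX₂ h.measZ₂ i₂ h.indep₂ h.lawZ₂
  have o₁ := isOpenPosMeasure_map_chan (γ := γ) h.measX₁ h.measZ₁ i₁ h.indep₁ h.lawZ₁
  have o₂ := isOpenPosMeasure_map_chan (γ := γ) h.measX₂ h.measZ₂ i₂ h.indep₂ h.lawZ₂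
  have q₁ : IsProbabilityMeasure (P.map (chan γ X₁ Z₁)) := P.isProbabilityMeasure_map
    m₁.aemeasurable
  have q₂ : IsProbabilityMeasure (P.map (chan γ X₂ Z₂)) := P.isProbabilityMeasure_map
    m₂.aemeasurable
  set g := postMean (P.map (mix α X₁ X₂)) √γ
  set g₁ := postMean (P.map X₁) √γ
  set g₂ := postMean (P.map X₂) √γ
  have cL : Continuous fun q : E n × E n => g (√(1 - α) • q.1 + √α • q.2) := by fun_prop
  have cR : Continuous fun q : E n × E n => √(1 - α) • g₁ q.1 + √α • g₂ q.2 := by fun_prop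
  -- The law of `(Y₁, Y₂)` is a product of measures with full support, so the almost sure identity
  -- of continuous functions holds at every point.
  have hpair : (fun q : E n × E n => g (√(1 - α) • q.1 + √α • q.2))
      = fun q => √(1 - α) • g₁ q.1 + √α • g₂ q.2 := by
    refine (cL.ae_eq_iff_eq ((P.map (chan γ X₁ Z₁)).prod (P.map (chan γ X₂ Z₂))) cR).1 ?_
    rw [← (indepFun_iff_map_prod_eq_prod_map_map m₁.aemeasurable m₂.aemeasurable).1
      (h.indepFun_chan γ)]
    refine (ae_map_iff (m₁.prodMk m₂).aemeasurable
      (measurableSet_eq_fun cL.measurable cR.measurable)).2 ?_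
    filter_upwards [heq, h.condMean_pair α γ, h.condMean_mix_chan hα0.le hα1.le γ, e₁, e₂]
      with ω k1 k2 k3 k4 k5
    rw [k3, k2] at k1
    simp only [mix, k4, k5] at k1
    exact k1
  obtain ⟨A, hA₁, hA₂⟩ := exists_affine_of_pexider gc (Real.sqrt_pos.2 (sub_pos.2 hα1)).ne'
    (Real.sqrt_pos.2 hα0).ne' fun x y => congrFun hpair (x, y)
  refine gaussian_of_condMean_affine hγ h.measX₁ h.measX₂ h.measZ₁ h.measZ₂ h.memLpX₁ h.memLpX₂
    h.indep₁ h.indep₂ h.lawZ₁ h.lawZ₂ (A := A) (c₁ := g₁ 0) (c₂ := g₂ 0) ?_ ?_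
  · filter_upwards [e₁] with ω hω
    rw [hω, hA₁]
  · filter_upwards [e₂] with ω hω
    rw [hω, hA₂]

/-- At each `γ > 0` the integrand vanishes exactly under the Gaussian condition, which does not
depend on `γ`. -/
lemma deficit_eq_zero_iff_gaussian [IsProbabilityMeasure P] (h : IsChannelPair P X₁ X₂ Z₁ Z₂)
    (hα0 : 0 < α) (hα1 : α < 1) :
    deficit P α X₁ X₂ Z₁ Z₂ = 0 ↔
      HasGaussianLaw X₁ P ∧ HasGaussianLaw X₂ P ∧ covMatrix X₁ P = covMatrix X₂ P := by
  have i₁ := h.memLpX₁.integrable one_le_two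
  have i₂ := h.memLpX₂.integrable one_le_two
  have mX := measurable_mix α h.measX₁ h.measX₂
  have p : IsProbabilityMeasure (P.map (mix α X₁ X₂)) := P.isProbabilityMeasure_map mX.aemeasurable
  have p₁ : IsProbabilityMeasure (P.map X₁) := P.isProbabilityMeasure_map h.measX₁.aemeasurable
  have p₂ : IsProbabilityMeasure (P.map X₂) := P.isProbabilityMeasure_map h.measX₂.aemeasurable
  -- A jointly measurable version of the difference of conditional means.
  let Φ : ℝ × Ω → E n := fun q =>
    postMean (P.map (mix α X₁ X₂)) √q.1 (mix α (chan q.1 X₁ Z₁) (chan q.1 X₂ Z₂) q.2)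
      - mix α (fun ω => postMean (P.map X₁) √q.1 (chan q.1 X₁ Z₁ ω))
          (fun ω => postMean (P.map X₂) √q.1 (chan q.1 X₂ Z₂ ω)) q.2
  have hs : Measurable fun q : ℝ × Ω => √q.1 := by fun_prop
  have c₁ : Measurable fun q : ℝ × Ω => chan q.1 X₁ Z₁ q.2 :=
    (hs.smul (h.measX₁.comp measurable_snd)).add (h.measZ₁.comp measurable_snd)
  have c₂ : Measurable fun q : ℝ × Ω => chan q.1 X₂ Z₂ q.2 :=
    (hs.smul (h.measX₂.comp measurable_snd)).add (h.measZ₂.comp measurable_snd)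
  have hΦ : Measurable Φ := by
    have k := (measurable_uncurry_postMean (P.map (mix α X₁ X₂))).comp
      (hs.prodMk ((c₁.const_smul √(1 - α)).add (c₂.const_smul √α)))
    have k₁ := (measurable_uncurry_postMean (P.map X₁)).comp (hs.prodMk c₁)
    have k₂ := (measurable_uncurry_postMean (P.map X₂)).comp (hs.prodMk c₂)
    exact k.sub ((k₁.const_smul √(1 - α)).add (k₂.const_smul √α))
  have hF : Measurable fun γ => ∫⁻ ω, ‖Φ (γ, ω)‖ₑ ^ 2 ∂P :=
    (hΦ.enorm.pow_const 2).lintegral_prod_right'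
  have hpt : ∀ γ : ℝ, ∫⁻ ω,
      ‖condMean P (mix α X₁ X₂) (mix α (chan γ X₁ Z₁) (chan γ X₂ Z₂)) ω
        - condMean P (mix α X₁ X₂) (fun ω' => (chan γ X₁ Z₁ ω', chan γ X₂ Z₂ ω')) ω‖ₑ ^ 2 ∂P
      = ∫⁻ ω, ‖Φ (γ, ω)‖ₑ ^ 2 ∂P := by
    intro γ
    refine lintegral_congr_ae ?_
    filter_upwards [h.condMean_pair α γ, h.condMean_mix_chan hα0.le hα1.le γ,
      condMean_chan (γ := γ) h.measX₁ h.measZ₁ i₁ h.indep₁ h.lawZ₁,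
      condMean_chan (γ := γ) h.measX₂ h.measZ₂ i₂ h.indep₂ h.lawZ₂] with ω k2 k3 k4 k5
    simp only [k2, k3, Φ]
    simp only [mix, k4, k5]
  have hiff : ∀ γ : ℝ, 0 < γ → (∫⁻ ω, ‖Φ (γ, ω)‖ₑ ^ 2 ∂P = 0 ↔
      HasGaussianLaw X₁ P ∧ HasGaussianLaw X₂ P ∧ covMatrix X₁ P = covMatrix X₂ P) := by
    intro γ hγ
    rw [← hpt γ, lintegral_enorm_sub_sq_eq_zero_iff (by exact integrable_condExp)
      (by exact integrable_condExp),
      h.condMean_eq_iff_gaussian hα0 hα1 hγ]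
  have hdef : deficit P α X₁ X₂ Z₁ Z₂ = 0 ↔
      ∀ᵐ γ ∂(volume.restrict (Set.Ioi (0 : ℝ))), ∫⁻ ω, ‖Φ (γ, ω)‖ₑ ^ 2 ∂P = 0 := by
    rw [deficit, mul_eq_zero]
    simp_rw [hpt]
    rw [lintegral_eq_zero_iff hF]
    simp only [one_div, ENNReal.inv_eq_zero, ENNReal.ofNat_ne_top, false_or]
    rfl
  rw [hdef]
  constructor
  · intro hae
    -- The half-line has positive measure, so a property holding almost everywhere on it holds at
    -- some `γ > 0`.
    have : (ae (volume.restrict (Set.Ioi (0 : ℝ)))).NeBot := by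
      rw [ae_neBot, Ne, Measure.restrict_eq_zero]
      simp
    obtain ⟨γ, hγ, hγ0⟩ := (hae.and (ae_restrict_mem measurableSet_Ioi)).exists
    exact (hiff γ hγ0).1 hγ
  · intro hG
    filter_upwards [ae_restrict_mem measurableSet_Ioi] with γ hγ
    exact (hiff γ hγ).2 hG

lemma score_eq [IsProbabilityMeasure P] (h : IsChannelPair P X₁ X₂ Z₁ Z₂) (hα0 : 0 ≤ α)
    (hα1 : α ≤ 1) (γ : ℝ) :
    (fun ω => score (mix α (chan γ X₁ Z₁) (chan γ X₂ Z₂)) P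
        (mix α (chan γ X₁ Z₁) (chan γ X₂ Z₂) ω)) =ᵐ[P]
      fun ω => √γ • condMean P (mix α X₁ X₂) (mix α (chan γ X₁ Z₁) (chan γ X₂ Z₂)) ω
        - mix α (chan γ X₁ Z₁) (chan γ X₂ Z₂) ω := by
  have i₁ := h.memLpX₁.integrable one_le_two
  have i₂ := h.memLpX₂.integrable one_le_two
  filter_upwards [h.condMean_mix_chan hα0 hα1 γ] with ω hω
  rw [hω, mix_chan, score_chan (measurable_mix α h.measX₁ h.measX₂)
    (measurable_mix α h.measZ₁ h.measZ₂) (integrable_mix α i₁ i₂) (h.indepFun_mix α)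
    (hasLaw_mix_stdGaussian hα0 hα1 h.measZ₁ h.measZ₂ h.indepZ h.lawZ₁ h.lawZ₂)]

lemma mix_score_eq [IsProbabilityMeasure P] (h : IsChannelPair P X₁ X₂ Z₁ Z₂) (α γ : ℝ) :
    mix α (fun ω => score (chan γ X₁ Z₁) P (chan γ X₁ Z₁ ω))
        (fun ω => score (chan γ X₂ Z₂) P (chan γ X₂ Z₂ ω)) =ᵐ[P]
      fun ω => √γ • mix α (condMean P X₁ (chan γ X₁ Z₁)) (condMean P X₂ (chan γ X₂ Z₂)) ω
        - mix α (chan γ X₁ Z₁) (chan γ X₂ Z₂) ω := by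
  have i₁ := h.memLpX₁.integrable one_le_two
  have i₂ := h.memLpX₂.integrable one_le_two
  filter_upwards [condMean_chan (γ := γ) h.measX₁ h.measZ₁ i₁ h.indep₁ h.lawZ₁,
    condMean_chan (γ := γ) h.measX₂ h.measZ₂ i₂ h.indep₂ h.lawZ₂] with ω k₁ k₂
  simp only [mix, k₁, k₂, score_chan h.measX₁ h.measZ₁ i₁ h.indep₁ h.lawZ₁,
    score_chan h.measX₂ h.measZ₂ i₂ h.indep₂ h.lawZ₂]
  module

/-- Conditioning the mixed posterior means on the mixed output gives its posterior mean. -/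
lemma condMean_mix_condMean [IsProbabilityMeasure P] (h : IsChannelPair P X₁ X₂ Z₁ Z₂) (α γ : ℝ) :
    condMean P (mix α (condMean P X₁ (chan γ X₁ Z₁)) (condMean P X₂ (chan γ X₂ Z₂)))
        (mix α (chan γ X₁ Z₁) (chan γ X₂ Z₂))
      =ᵐ[P] condMean P (mix α X₁ X₂) (mix α (chan γ X₁ Z₁) (chan γ X₂ Z₂)) := by
  have m₁ := measurable_chan γ h.measX₁ h.measZ₁
  have m₂ := measurable_chan γ h.measX₂ h.measZ₂
  have hle : MeasurableSpace.comap (mix α (chan γ X₁ Z₁) (chan γ X₂ Z₂)) inferInstance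
      ≤ MeasurableSpace.comap (fun ω => (chan γ X₁ Z₁ ω, chan γ X₂ Z₂ ω)) inferInstance :=
    ((by fun_prop : Measurable fun q : E n × E n => √(1 - α) • q.1 + √α • q.2).comp
      (comap_measurable fun ω => (chan γ X₁ Z₁ ω, chan γ X₂ Z₂ ω))).comap_le
  exact (condExp_congr_ae (h.condMean_pair α γ).symm).trans
    (condExp_condExp_of_le hle (m₁.prodMk m₂).comap_le)

/-- With `score_eq`, this identifies the score of the mixed output as the conditional mean of the
mixed scores. -/
lemma condMean_mix_score [IsProbabilityMeasure P] (h : IsChannelPair P X₁ X₂ Z₁ Z₂) (α γ : ℝ) :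
    condMean P (mix α (fun ω => score (chan γ X₁ Z₁) P (chan γ X₁ Z₁ ω))
        (fun ω => score (chan γ X₂ Z₂) P (chan γ X₂ Z₂ ω)))
        (mix α (chan γ X₁ Z₁) (chan γ X₂ Z₂)) =ᵐ[P]
      fun ω => √γ • condMean P (mix α X₁ X₂) (mix α (chan γ X₁ Z₁) (chan γ X₂ Z₂)) ω
        - mix α (chan γ X₁ Z₁) (chan γ X₂ Z₂) ω := by
  have i₁ := h.memLpX₁.integrable one_le_two
  have i₂ := h.memLpX₂.integrable one_le_two
  have m₁ := measurable_chan γ h.measX₁ h.measZ₁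
  have m₂ := measurable_chan γ h.measX₂ h.measZ₂
  set Y := mix α (chan γ X₁ Z₁) (chan γ X₂ Z₂) with hY
  set M := mix α (condMean P X₁ (chan γ X₁ Z₁)) (condMean P X₂ (chan γ X₂ Z₂)) with hM
  have mY : Measurable Y := measurable_mix α m₁ m₂
  have iY : Integrable Y P := by
    have j₁ : Integrable (chan γ X₁ Z₁) P :=
      (i₁.smul √γ).add (integrable_of_hasLaw_stdGaussian h.lawZ₁)
    have j₂ : Integrable (chan γ X₂ Z₂) P :=
      (i₂.smul √γ).add (integrable_of_hasLaw_stdGaussian h.lawZ₂)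
    exact integrable_mix α j₁ j₂
  have iM : Integrable M P := integrable_mix α integrable_condExp integrable_condExp
  have hc : Y = condMean P Y Y :=
    (condExp_of_stronglyMeasurable mY.comap_le (comap_measurable Y).stronglyMeasurable iY).symm
  have k1 := condExp_congr_ae (m := MeasurableSpace.comap Y inferInstance) (h.mix_score_eq α γ)
  have k2 := condExp_sub (iM.smul √γ) iY (MeasurableSpace.comap Y inferInstance)
  have k3 := condExp_smul (μ := P) √γ M (MeasurableSpace.comap Y inferInstance)
  filter_upwards [k1, k2, k3, h.condMean_mix_condMean α γ] with ω e1 e2 e3 e4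
  refine e1.trans (e2.trans ?_)
  rw [Pi.sub_apply, e3, Pi.smul_apply]
  congr 1
  · exact congrArg _ e4
  · exact (congrFun hc ω).symm

/-- By Tweedie's formula the score is a combination of square-integrable vectors; its mean is 0
because conditioning preserves the mean of `X` and the noise is centred. -/
lemma memLp_score [IsProbabilityMeasure P] {X Z : Ω → E n} (hX : Measurable X) (hZ : Measurable Z)
    (hXL : MemLp X 2 P)
    (hXZ : IndepFun X Z P) (hZl : HasLaw Z (stdGaussian (E n)) P) :
    MemLp (fun ω => score (chan γ X Z) P (chan γ X Z ω)) 2 P ∧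
      ∫ ω, score (chan γ X Z) P (chan γ X Z ω) ∂P = 0 := by
  have hXi := hXL.integrable one_le_two
  have hZL : MemLp Z 2 P := hZl.hasGaussianLaw.memLp_two
  have hZi := integrable_of_hasLaw_stdGaussian hZl
  have hYL : MemLp (chan γ X Z) 2 P := (hXL.const_smul √γ).add hZL
  have hC : MemLp (condMean P X (chan γ X Z)) 2 P := hXL.condExp one_le_two
  have e : (fun ω => score (chan γ X Z) P (chan γ X Z ω)) =ᵐ[P]
      fun ω => √γ • condMean P X (chan γ X Z) ω - chan γ X Z ω := by
    filter_upwards [condMean_chan (γ := γ) hX hZ hXi hXZ hZl] with ω hω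
    rw [hω, score_chan hX hZ hXi hXZ hZl]
  refine ⟨((hC.const_smul √γ).sub hYL).ae_eq e.symm, ?_⟩
  have hCi : Integrable (fun ω => √γ • condMean P X (chan γ X Z) ω) P :=
    (hC.integrable one_le_two).smul √γ
  have hXs : Integrable (fun ω => √γ • X ω) P := hXi.smul √γ
  rw [integral_congr_ae e, integral_sub hCi (hYL.integrable one_le_two), integral_smul]
  have e2 : ∫ ω, condMean P X (chan γ X Z) ω ∂P = ∫ ω, X ω ∂P :=
    integral_condExp (measurable_chan γ hX hZ).comap_le
  have e3 : ∫ ω, chan γ X Z ω ∂P = √γ • ∫ ω, X ω ∂P + ∫ ω, Z ω ∂P := by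
    unfold chan
    rw [integral_add hXs hZi, integral_smul]
  rw [e2, e3, hZl.integral_eq, integral_id_stdGaussian]
  simp

/-- By independence and centring, the left side of the Fisher identity is the second moment of the
mixed score. The right side is that of its projection onto `σ(Y)`. -/
lemma fisherInfo_eq_iff [IsProbabilityMeasure P] (h : IsChannelPair P X₁ X₂ Z₁ Z₂) (hα0 : 0 ≤ α)
    (hα1 : α ≤ 1) (γ : ℝ) :
    (fun ω => score (mix α (chan γ X₁ Z₁) (chan γ X₂ Z₂)) P
        (mix α (chan γ X₁ Z₁) (chan γ X₂ Z₂) ω)) =ᵐ[P]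
      mix α (fun ω => score (chan γ X₁ Z₁) P (chan γ X₁ Z₁ ω))
        (fun ω => score (chan γ X₂ Z₂) P (chan γ X₂ Z₂ ω)) ↔
    ENNReal.ofReal (1 - α) * fisherInfo (chan γ X₁ Z₁) P
        + ENNReal.ofReal α * fisherInfo (chan γ X₂ Z₂) P
      = fisherInfo (mix α (chan γ X₁ Z₁) (chan γ X₂ Z₂)) P := by
  have i₁ := h.memLpX₁.integrable one_le_two
  have i₂ := h.memLpX₂.integrable one_le_two
  have m₁ := measurable_chan γ h.measX₁ h.measZ₁
  have m₂ := measurable_chan γ h.measX₂ h.measZ₂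
  have mscore : ∀ {X Z : Ω → E n}, Measurable X → Measurable Z → Integrable X P →
      IndepFun X Z P → HasLaw Z (stdGaussian (E n)) P → Measurable (score (chan γ X Z) P) := by
    intro X Z hX hZ hXi hXZ hZl
    have p : IsProbabilityMeasure (P.map X) := P.isProbabilityMeasure_map hX.aemeasurable
    have := (continuous_postMean (s := √γ) (integrable_id_map hX hXi)).measurable
    rw [funext (score_chan (γ := γ) hX hZ hXi hXZ hZl)]
    fun_prop
  obtain ⟨L₁, z₁⟩ := memLp_score (γ := γ) h.measX₁ h.measZ₁ h.memLpX₁ h.indep₁ h.lawZ₁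
  obtain ⟨L₂, -⟩ := memLp_score (γ := γ) h.measX₂ h.measZ₂ h.memLpX₂ h.indep₂ h.lawZ₂
  have hind := (h.indepFun_chan γ).comp (mscore h.measX₁ h.measZ₁ i₁ h.indep₁ h.lawZ₁)
    (mscore h.measX₂ h.measZ₂ i₂ h.indep₂ h.lawZ₂)
  rw [fisherInfo, fisherInfo, fisherInfo, lintegral_enorm_sq_mix L₁ L₂ hind z₁ hα0 hα1]
  exact ae_eq_condMean_iff_lintegral_enorm_sq_eq (measurable_mix α m₁ m₂) (memLp_mix α L₁ L₂)
    ((h.score_eq hα0 hα1 γ).trans (h.condMean_mix_score α γ).symm)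

end IsChannelPair

lemma smul_sub_ae_eq_iff {P : Measure Ω} {U V W : Ω → E n} {s : ℝ} (hs : s ≠ 0) :
    (fun ω => s • U ω - W ω) =ᵐ[P] (fun ω => s • V ω - W ω) ↔ U =ᵐ[P] V := by
  refine Filter.eventually_congr (ae_of_all _ fun ω => ?_)
  rw [sub_left_inj]
  exact (smul_right_injective _ hs).eq_iff

lemma ae_eq_congr_iff {P : Measure Ω} {U U' V V' : Ω → E n} (hU : U =ᵐ[P] U') (hV : V =ᵐ[P] V') :
    U =ᵐ[P] V ↔ U' =ᵐ[P] V' :=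
  ⟨fun h => hU.symm.trans (h.trans hV), fun h => hU.trans (h.trans hV.symm)⟩

end EPI

open EPI
theorem mainTheorem2 {n : ℕ} {Ω : Type*} {mΩ : MeasurableSpace Ω} (P : Measure Ω)
    [IsProbabilityMeasure P] (X₁ X₂ Z₁ Z₂ : Ω → EPI.E n)
    (hX₁ : Measurable X₁) (hX₂ : Measurable X₂) (hZ₁ : Measurable Z₁) (hZ₂ : Measurable Z₂)
    (hindep : iIndepFun ![X₁, X₂, Z₁, Z₂] P)
    (hX₁_L2 : MemLp X₁ 2 P) (hX₂_L2 : MemLp X₂ 2 P)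
    (hX₁_dens : HasRegularDensity X₁ P) (hX₂_dens : HasRegularDensity X₂ P)
    (hZ₁_law : HasLaw Z₁ (stdGaussian (EPI.E n)) P)
    (hZ₂_law : HasLaw Z₂ (stdGaussian (EPI.E n)) P)
    (α : ℝ) (hα0 : 0 < α) (hα1 : α < 1) :
    (∀ γ : ℝ, 0 < γ →
      ∀ Y₁ Y₂ Y X : Ω → EPI.E n, Y₁ = chan γ X₁ Z₁ → Y₂ = chan γ X₂ Z₂ →
        Y = mix α Y₁ Y₂ → X = mix α X₁ X₂ →
      List.TFAE [
        deficit P α X₁ X₂ Z₁ Z₂ = 0,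
        condMean P X Y =ᵐ[P] condMean P X (fun ω => (Y₁ ω, Y₂ ω)),
        condMean P (mix α (condMean P X₁ Y₁) (condMean P X₂ Y₂)) Y
          =ᵐ[P] mix α (condMean P X₁ Y₁) (condMean P X₂ Y₂),
        condMean P (mix α (fun ω => score Y₁ P (Y₁ ω)) (fun ω => score Y₂ P (Y₂ ω))) Y
          =ᵐ[P] mix α (fun ω => score Y₁ P (Y₁ ω)) (fun ω => score Y₂ P (Y₂ ω)),
        (fun ω => score Y P (Y ω))
          =ᵐ[P] mix α (fun ω => score Y₁ P (Y₁ ω)) (fun ω => score Y₂ P (Y₂ ω)),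
        ENNReal.ofReal (1 - α) * fisherInfo Y₁ P + ENNReal.ofReal α * fisherInfo Y₂ P
          = fisherInfo Y P]) ∧
    (deficit P α X₁ X₂ Z₁ Z₂ = 0 ↔
      HasGaussianLaw X₁ P ∧ HasGaussianLaw X₂ P ∧ covMatrix X₁ P = covMatrix X₂ P) := by
  have hmeas : ∀ i, Measurable ((![X₁, X₂, Z₁, Z₂] : Fin 4 → Ω → EPI.E n) i) := by
    intro i
    fin_cases i <;> assumption
  have h : IsChannelPair P X₁ X₂ Z₁ Z₂ :=
    { measX₁ := hX₁
      measX₂ := hX₂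
      measZ₁ := hZ₁
      measZ₂ := hZ₂
      memLpX₁ := hX₁_L2
      memLpX₂ := hX₂_L2
      indep₁ := hindep.indepFun (i := 0) (j := 2) (by decide)
      indep₂ := hindep.indepFun (i := 1) (j := 3) (by decide)
      indepZ := hindep.indepFun (i := 2) (j := 3) (by decide)
      indepPairs := hindep.indepFun_prodMk_prodMk hmeas 0 2 1 3 (by decide) (by decide)
        (by decide) (by decide)
      indepNoise := hindep.indepFun_prodMk_prodMk hmeas 0 1 2 3 (by decide) (by decide)
        (by decide) (by decide)
      lawZ₁ := hZ₁_law
      lawZ₂ := hZ₂_law }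
  refine ⟨?_, h.deficit_eq_zero_iff_gaussian hα0 hα1⟩
  rintro γ hγ _ _ _ _ rfl rfl rfl rfl
  have hs : √γ ≠ 0 := (Real.sqrt_pos.2 hγ).ne'
  -- The passage from all `γ` to the given one goes through the Gaussian condition.
  tfae_have 1 ↔ 2 := (h.deficit_eq_zero_iff_gaussian hα0 hα1).trans
    (h.condMean_eq_iff_gaussian hα0 hα1 hγ).symm
  tfae_have 2 ↔ 3 := (ae_eq_congr_iff .rfl (h.condMean_pair α γ)).trans
    (ae_eq_congr_iff (h.condMean_mix_condMean α γ) .rfl).symm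
  -- Both sides have the form `√γ • u - Y`; cancelling `Y` and `√γ ≠ 0` leaves the posterior means.
  tfae_have 4 ↔ 2 := (ae_eq_congr_iff (h.condMean_mix_score α γ) (h.mix_score_eq α γ)).trans
    ((smul_sub_ae_eq_iff hs).trans (ae_eq_congr_iff .rfl (h.condMean_pair α γ)).symm)
  tfae_have 5 ↔ 2 := (ae_eq_congr_iff (h.score_eq hα0.le hα1.le γ) (h.mix_score_eq α γ)).trans
    ((smul_sub_ae_eq_iff hs).trans (ae_eq_congr_iff .rfl (h.condMean_pair α γ)).symm)
  tfae_have 5 ↔ 6 := h.fisherInfo_eq_iff hα0.le hα1.le γ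
  tfae_finish
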